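/- **Definitions.** Write $x^g=g^{-1}xg$. A group $G$ with elements $a,b,c$ is a *triangle-point group* $G=\langle a,b,c\rangle$ if $a,b,c$ generate $G$, each of $a,b,c,ab$ has order $2$, and $ts$ has order at most $6$ for all $t,s\in a^G\cup b^G\cup c^G\cup(ab)^G$. Let $V$ be a real vector space with a (positive definite) inner product $(\,,)$ and a commutative bilinear product $\cdot$ . For $a\in V$ let $V_\mu^{(a)}=\{v: a\cdot v=\mu v\}$. A *Majorana axis* is $a\in V$ such that: $(a,a)=1$ and $a\cdot a=a$; $V=V_1^{(a)}\oplus V_0^{(a)}\oplus V_{1/4}^{(a)}\oplus V_{1/32}^{(a)}$; $V_1^{(a)}=\mathbb Ra$; the linear map $\tau(a)$ that is $1$ on $V_1^{(a)},V_0^{(a)},V_{1/4}^{(a)}$ and $-1$ on $V_{1/32}^{(a)}$ preserves the product; and the linear map of $V_+^{(a)}=V_1^{(a)}\oplus V_0^{(a)}\oplus V_{1/4}^{(a)}$ that is $1$ on $V_1^{(a)},V_0^{(a)}$ and $-1$ on $V_{1/4}^{(a)}$ preserves the restricted product. Axes $a_0,a_1$ *generate an algebra of type $2A$ with third axis $a_\rho$*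 if $a_0,a_1,a_\rho$ are linearly independent idempotents of length $1$ with pairwise inner products $\frac18$, and $x\cdot y=\frac18(x+y-z)$ whenever $\{x,y,z\}=\{a_0,a_1,a_\rho\}$. A *Majorana representation* $(G,T,V)$ of a finite group $G$ consists of a conjugation-stable generating set $T$ of involutions of $G$, an algebra $V$ as above with $(u,v\cdot w)=(u\cdot v,w)$ and $(u\cdot u,v\cdot v)\ge(u\cdot v,u\cdot v)$ for all $u,v,w\in V$, a linear representation $\varphi$ of $G$ on $V$ preserving both products, and a bijection $\psi$ from $T$ onto a set of Majorana axes generating the algebra $V$, with $\psi(t^g)=\psi(t)^{\varphi(g)}$ and $\varphi(t)=\tau(\psi(t))$ for $t\in T$, $g\in G$, such that: if $t_0,t_1\in T$ and $\psi(t_0),\psi(t_1)$ generate an algebra of type $2A$ with third axis $a_\rho$, then $t_0t_1\in T$ and $\psi(t_0t_1)=a_\rho$; and if $t_0,t_1,t_2\in T$ and $t_0t_1t_2=1$, then $\psi(t_0),\psi(t_1)$ generate an algebra of type $2A$ with third axis $\psi(t_2)$. Let $G_9\le S_{12}$ be the permutation group generated by $(1,2)(3,4)(5,6)(7,8)$,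 $(1,8)(2,7)(3,4)(5,6)$ and $(2,5)(3,6)(9,10)(11,12)$; it has order $1152$ and shape $(2^4:(S_3\times S_3))\times 2$. **Proposition.** Let $G=\langle a,b,c\rangle$ be a triangle-point group isomorphic to $G_9$. 1. If $T\subseteq G$ and $a,b,c,ab\in T$, then there is no Majorana representation of the form $(G,T,V)$. 2. Suppose moreover that $a,b,c$ satisfy the defining relations of $G_9$, i.e. $a^2=b^2=c^2=(ab)^2=(ac)^6=(bc)^6=(abc)^6=(a\cdot b^c)^4=(ab\cdot b^c)^6=(ab\cdot a^c)^6=1$. Then $K=\langle a,b,(ab\cdot c^{ac})^3\rangle$ is isomorphic to $2^3$, and $K\subseteq T\cup\{e\}$ for every conjugation-stable set $T$ of involutions of $G$ that contains $a,b,c,ab$ and contains $(ts)^3$ whenever $t,s\in T$ and $ts$ has order $6$. -/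

import Mathlib

section MajoranaTheory

variable {V : Type*} [AddCommGroup V] [Module ℝ V]

/-- The `μ`-eigenspace of the adjoint action `v ↦ a · v` of `a`. -/
def axisEigenspace (mul : V →ₗ[ℝ] V →ₗ[ℝ] V) (a : V) (μ : ℝ) : Submodule ℝ V :=
  Module.End.eigenspace (mul a) μ

/-- The four eigenvalues allowed for a Majorana axis: `1`, `0`, `1/2^2`, `1/2^5`. -/
noncomputable def axisEigenvalue : Fin 4 → ℝ :=
  ![1, 0, 1 / 2 ^ 2, 1 / 2 ^ 5]

/-- `τ` is the map `τ(a)`: it is the identity on the `1`-, `0`- and `1/4`-eigenvectors of `a`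
and minus the identity on the `1/32`-eigenvectors. (When `V` is the sum of these eigenspaces
there is exactly one such linear map.) -/
structure IsTau (mul : V →ₗ[ℝ] V →ₗ[ℝ] V) (a : V) (τ : V →ₗ[ℝ] V) : Prop where
  one : ∀ u ∈ axisEigenspace mul a 1, τ u = u
  zero : ∀ u ∈ axisEigenspace mul a 0, τ u = u
  quarter : ∀ u ∈ axisEigenspace mul a (1 / 2 ^ 2), τ u = u
  thirtysecond : ∀ u ∈ axisEigenspace mul a (1 / 2 ^ 5), τ u = -u

/-- `V₊ = V₁ ⊕ V₀ ⊕ V_{1/4}`, the subspace fixed by `τ(a)`. -/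
noncomputable def plusSpace (mul : V →ₗ[ℝ] V →ₗ[ℝ] V) (a : V) : Submodule ℝ V :=
  axisEigenspace mul a 1 ⊔ axisEigenspace mul a 0 ⊔ axisEigenspace mul a (1 / 2 ^ 2)

/-- `σ` is the map `σ(a)` of `V₊`: it is the identity on the `1`- and `0`-eigenvectors of `a`
and minus the identity on the `1/4`-eigenvectors. -/
structure IsSigma (mul : V →ₗ[ℝ] V →ₗ[ℝ] V) (a : V)
    (σ : plusSpace mul a →ₗ[ℝ] plusSpace mul a) : Prop where
  one : ∀ u : plusSpace mul a, (u : V) ∈ axisEigenspace mul a 1 → σ u = u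
  zero : ∀ u : plusSpace mul a, (u : V) ∈ axisEigenspace mul a 0 → σ u = u
  quarter : ∀ u : plusSpace mul a, (u : V) ∈ axisEigenspace mul a (1 / 2 ^ 2) → σ u = -u

/-- The conditions (M3)-(M7) on a Majorana axis `a`. -/
structure IsMajoranaAxis (mul : V →ₗ[ℝ] V →ₗ[ℝ] V) (form : V →ₗ[ℝ] V →ₗ[ℝ] ℝ) (a : V) :
    Prop where
  length_one : form a a = 1
  idem : mul a a = a
  decomp : DirectSum.IsInternal (fun i : Fin 4 => axisEigenspace mul a (axisEigenvalue i))
  one_space : axisEigenspace mul a 1 = Submodule.span ℝ {a}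
  tau_aut : ∃ τ : V →ₗ[ℝ] V, IsTau mul a τ ∧ ∀ u v : V, mul (τ u) (τ v) = τ (mul u v)
  /-- `σ(a)` preserves the restriction of the product to `V₊`
  (which is closed under the product by the previous condition). -/
  sigma_aut : ∃ σ : plusSpace mul a →ₗ[ℝ] plusSpace mul a, IsSigma mul a σ ∧
    ∀ u v w : plusSpace mul a, (w : V) = mul (u : V) (v : V) →
      mul (σ u : V) (σ v : V) = (σ w : V)

/-- `a₀` and `a₁` generate a dihedral algebra of type `2A` with third axis `aρ`: the subalgebra
generated by `a₀, a₁` has basis `a₀, a₁, aρ` with the products and inner products of the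
type `2A` algebra. -/
structure IsType2A (mul : V →ₗ[ℝ] V →ₗ[ℝ] V) (form : V →ₗ[ℝ] V →ₗ[ℝ] ℝ) (a₀ a₁ aρ : V) :
    Prop where
  indep : LinearIndependent ℝ ![a₀, a₁, aρ]
  idem₀ : mul a₀ a₀ = a₀
  idem₁ : mul a₁ a₁ = a₁
  idemρ : mul aρ aρ = aρ
  mul₀₁ : mul a₀ a₁ = (1 / 2 ^ 3 : ℝ) • (a₀ + a₁ - aρ)
  mul₀ρ : mul a₀ aρ = (1 / 2 ^ 3 : ℝ) • (a₀ + aρ - a₁)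
  mul₁ρ : mul a₁ aρ = (1 / 2 ^ 3 : ℝ) • (a₁ + aρ - a₀)
  form₀₀ : form a₀ a₀ = 1
  form₁₁ : form a₁ a₁ = 1
  formρρ : form aρ aρ = 1
  form₀₁ : form a₀ a₁ = 1 / 2 ^ 3
  form₀ρ : form a₀ aρ = 1 / 2 ^ 3
  form₁ρ : form a₁ aρ = 1 / 2 ^ 3

end MajoranaTheory

/-- A Majorana representation `(G, T, V, ·, (,), φ, ψ)` of a (finite) group `G`, satisfying
(M1)-(M8). The set of Majorana axes is `A = ψ(T)`. -/
structure MajoranaRepresentation (G : Type*) [Group G] (T : Set G)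
    (V : Type*) [AddCommGroup V] [Module ℝ V] where
  /-- every element of `T` is an involution -/
  involution : ∀ t ∈ T, orderOf t = 2
  /-- `T` is closed under conjugation in `G` -/
  stable : ∀ t ∈ T, ∀ g : G, g * t * g⁻¹ ∈ T
  /-- `T` generates `G` -/
  generates : Subgroup.closure T = ⊤
  /-- the bilinear algebra product -/
  mul : V →ₗ[ℝ] V →ₗ[ℝ] V
  mul_comm : ∀ u v : V, mul u v = mul v u
  /-- the inner product -/
  form : V →ₗ[ℝ] V →ₗ[ℝ] ℝ
  form_symm : ∀ u v : V, form u v = form v u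
  form_pos : ∀ u : V, u ≠ 0 → 0 < form u u
  /-- (M1) -/
  assoc : ∀ u v w : V, form u (mul v w) = form (mul u v) w
  /-- (M2), the Norton inequality -/
  norton : ∀ u v : V, form (mul u v) (mul u v) ≤ form (mul u u) (mul v v)
  /-- the linear representation of `G` -/
  φ : G →* (V ≃ₗ[ℝ] V)
  φ_mul : ∀ (g : G) (u v : V), φ g (mul u v) = mul (φ g u) (φ g v)
  φ_form : ∀ (g : G) (u v : V), form (φ g u) (φ g v) = form u v
  /-- the bijection from `T` to the set of axes `A = ψ(T)` -/
  ψ : T → V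
  ψ_injective : Function.Injective ψ
  /-- (M3)-(M7) -/
  axis : ∀ t : T, IsMajoranaAxis mul form (ψ t)
  /-- the axes generate the algebra `V` -/
  axes_generate : ∀ U : Submodule ℝ V, (∀ t : T, ψ t ∈ U) →
    (∀ u ∈ U, ∀ v ∈ U, mul u v ∈ U) → U = ⊤
  ψ_conj : ∀ (t : T) (g : G), ψ ⟨g * t * g⁻¹, stable t t.2 g⟩ = φ g (ψ t)
  /-- `φ(t)` is the Majorana involution `τ(ψ(t))` of the axis `ψ(t)` -/
  φ_eq_tau : ∀ t : T, IsTau mul (ψ t) (φ (t : G) : V →ₗ[ℝ] V)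
  /-- (M8), first half -/
  mem_of_type2A : ∀ (t₀ t₁ : T) (aρ : V), IsType2A mul form (ψ t₀) (ψ t₁) aρ →
    ∃ h : (t₀ * t₁ : G) ∈ T, ψ ⟨t₀ * t₁, h⟩ = aρ
  /-- (M8), second half -/
  type2A_of_mul : ∀ t₀ t₁ t₂ : T, (t₀ * t₁ * t₂ : G) = 1 →
    IsType2A mul form (ψ t₀) (ψ t₁) (ψ t₂)

/-- `G = ⟨a, b, c⟩` is a triangle-point group: `a, b, c, ab` have order `2`, and the product of
any two elements of `a^G ∪ b^G ∪ c^G ∪ (ab)^G` has (finite) order at most `6`. -/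
structure IsTrianglePoint {G : Type*} [Group G] (a b c : G) : Prop where
  generates : Subgroup.closure {a, b, c} = (⊤ : Subgroup G)
  order_a : orderOf a = 2
  order_b : orderOf b = 2
  order_c : orderOf c = 2
  order_ab : orderOf (a * b) = 2
  order_le : ∀ x ∈ ({a, b, c, a * b} : Set G), ∀ y ∈ ({a, b, c, a * b} : Set G),
    ∀ t s : G, IsConj x t → IsConj y s → 0 < orderOf (t * s) ∧ orderOf (t * s) ≤ 6

/-- `conjBy x g` is `x^g = g⁻¹ x g`. -/
def conjBy {G : Type*} [Group G] (x g : G) : G :=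
  g⁻¹ * x * g

/-- `a, b, c` satisfy the defining relations of `G₉`. -/
def SatisfiesG9Relations {G : Type*} [Group G] (a b c : G) : Prop :=
  a ^ 2 = 1 ∧ b ^ 2 = 1 ∧ c ^ 2 = 1 ∧ (a * b) ^ 2 = 1 ∧
  (a * c) ^ 6 = 1 ∧ (b * c) ^ 6 = 1 ∧ (a * b * c) ^ 6 = 1 ∧
  (a * conjBy b c) ^ 4 = 1 ∧ (a * b * conjBy b c) ^ 6 = 1 ∧ (a * b * conjBy a c) ^ 6 = 1

open Equiv in
/-- The group `G₉ ≅ (2^4 : (S₃ × S₃)) × 2` of order `1152`, as the group of permutations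
of twelve points (labelled `0, …, 11` instead of `1, …, 12`) generated by
`(1,2)(3,4)(5,6)(7,8)`, `(1,8)(2,7)(3,4)(5,6)` and `(2,5)(3,6)(9,10)(11,12)`. -/
def G9 : Subgroup (Perm (Fin 12)) :=
  Subgroup.closure
    {swap 0 1 * swap 2 3 * swap 4 5 * swap 6 7,
     swap 0 7 * swap 1 6 * swap 2 3 * swap 4 5,
     swap 1 4 * swap 2 5 * swap 8 9 * swap 10 11}

/-- The subgroup `K = ⟨a, b, (ab · c^{ac})³⟩`. -/
def subgroupK {G : Type*} [Group G] (a b c : G) : Subgroup G :=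
  Subgroup.closure {a, b, (a * b * conjBy c (a * c)) ^ 3}

/-! ### Eigenspace decomposition and fusion rules of a single axis -/

section AxisFusion

variable {V : Type*} [AddCommGroup V] [Module ℝ V]
  {mul : V →ₗ[ℝ] V →ₗ[ℝ] V} {form : V →ₗ[ℝ] V →ₗ[ℝ] ℝ} {a : V}

/-! Two facts about Majorana representations are played against the structure of the group.

First, `T` contains `(ts)³` whenever `t, s ∈ T` and `ts` has order 6 (`pow_three_mem`). The six
reflections of the dihedral group `⟨t, s⟩` give a hexagon of axes. Opposite axes have commuting
Majorana involutions, so they either annihilate each other or generate a `2A` algebra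
(`mul_eq_zero_or_isType2A`). Annihilation is impossible (`mul_opposite_ne_zero`), and in the `2A`
case the third axis belongs to `(ts)³`. The tool is the resurrection principle: the `0`- and
`1/4`-parts of an axis are written through the same unknown product, the fusion rules are applied to
both, and the terms that cannot be computed are eliminated.

Second, no subgroup `2³` has all its involutions in `T` (`false_of_pure`): the rule sending `V_{1/4}
V_{1/4}` into `V₁ ⊕ V₀` would force two distinct axes to coincide.

On the group side, `G₉` maps to two copies of `S₃` by `p`, `q`, has a central involution `z` and a
sign `ε` with `ε z = -1` (`DoubleS3Extension`). For a generating triple, each of `p`, `q` kills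
exactly one of `a, b, ab`, and they kill different ones. After renaming, `p b = 1 = q a` (`Good`).
With `w = c^{ac}` one finds `(ab·w)³ = z` and `(b·w)³ = az`; symmetry and conjugation give `bz` and
`abz`. So all involutions of `⟨a, b, z⟩ ≅ 2³` lie in `T`, contradicting the second fact. The
relation `(a·b^c)⁴ = 1` makes the renaming unnecessary, and then `K = ⟨a, b, z⟩`. -/

theorem mem_axisEigenspace {μ : ℝ} {v : V} : v ∈ axisEigenspace mul a μ ↔ mul a v = μ • v :=
  Module.End.mem_eigenspace_iff

theorem IsMajoranaAxis.exists_decomposition (ha : IsMajoranaAxis mul form a) (y : V) :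
    ∃ (r : ℝ) (u v w : V), y = r • a + u + v + w ∧ mul a u = 0 ∧
      mul a v = (1 / 4 : ℝ) • v ∧ mul a w = (1 / 32 : ℝ) • w := by
  have hy : y ∈ ⨆ i : Fin 4, axisEigenspace mul a (axisEigenvalue i) := by
    rw [ha.decomp.submodule_iSup_eq_top]; trivial
  refine Submodule.iSup_induction _ (motive := fun y => ∃ (r : ℝ) (u v w : V),
    y = r • a + u + v + w ∧ mul a u = 0 ∧ mul a v = (1 / 4 : ℝ) • v ∧
      mul a w = (1 / 32 : ℝ) • w) hy ?_ ?_ ?_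
  · intro i x hx
    fin_cases i
    · have hx1 : x ∈ axisEigenspace mul a 1 := by simpa [axisEigenvalue] using hx
      rw [ha.one_space] at hx1
      obtain ⟨r, rfl⟩ := Submodule.mem_span_singleton.1 hx1
      exact ⟨r, 0, 0, 0, by simp, by simp, by simp, by simp⟩
    · refine ⟨0, x, 0, 0, by simp, ?_, by simp, by simp⟩
      simpa [axisEigenvalue] using mem_axisEigenspace.1 hx
    · refine ⟨0, 0, x, 0, by simp, by simp, ?_, by simp⟩
      have := mem_axisEigenspace.1 hx
      simp only [axisEigenvalue] at this
      norm_num at this ⊢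
      exact this
    · refine ⟨0, 0, 0, x, by simp, by simp, by simp, ?_⟩
      have := mem_axisEigenspace.1 hx
      simp only [axisEigenvalue] at this
      norm_num at this ⊢
      exact this
  · exact ⟨0, 0, 0, 0, by simp⟩
  · rintro x y ⟨r, u, v, w, rfl, hu, hv, hw⟩ ⟨r', u', v', w', rfl, hu', hv', hw'⟩
    exact ⟨r + r', u + u', v + v', w + w', by module, by simp [hu, hu'], by simp [hv, hv'],
      by simp [hw, hw']⟩

theorem IsTau.apply_decomposition {τ : V →ₗ[ℝ] V} (hτ : IsTau mul a τ) (hidem : mul a a = a)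
    {r : ℝ} {u v w : V} (hu : mul a u = 0) (hv : mul a v = (1 / 4 : ℝ) • v)
    (hw : mul a w = (1 / 32 : ℝ) • w) : τ (r • a + u + v + w) = r • a + u + v - w := by
  have h1 : τ a = a := hτ.one a (mem_axisEigenspace.2 (by simpa using hidem))
  have h2 : τ u = u := hτ.zero u (mem_axisEigenspace.2 (by simpa using hu))
  have h3 : τ v = v := hτ.quarter v (mem_axisEigenspace.2 (by rw [hv]; norm_num))
  have h4 : τ w = -w := hτ.thirtysecond w (mem_axisEigenspace.2 (by rw [hw]; norm_num))
  simp [h1, h2, h3, h4, sub_eq_add_neg]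

theorem mem_plusSpace_of_eq {r : ℝ} {x u v : V} (hidem : mul a a = a) (hx : x = r • a + u + v)
    (hu : mul a u = 0) (hv : mul a v = (1 / 4 : ℝ) • v) : x ∈ plusSpace mul a := by
  subst hx
  refine Submodule.add_mem_sup (Submodule.add_mem_sup ?_ ?_) ?_
  · exact Submodule.smul_mem _ _ (mem_axisEigenspace.2 (by simpa using hidem))
  · exact mem_axisEigenspace.2 (by simpa using hu)
  · exact mem_axisEigenspace.2 (by rw [hv]; norm_num)

theorem eq_zero_of_eq_neg {v : V} (h : v = -v) : v = 0 := by
  have h2 : (2 : ℝ) • v = 0 := by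
    linear_combination (norm := module) h
  exact (smul_eq_zero.1 h2).resolve_left two_ne_zero

/-- The `τ(a)`-fixed vectors form `V₁ ⊕ V₀ ⊕ V_{1/4}`. -/
theorem IsMajoranaAxis.exists_decomposition_of_fixed (ha : IsMajoranaAxis mul form a)
    {τ : V →ₗ[ℝ] V} (hτ : IsTau mul a τ) {y : V} (hy : τ y = y) :
    ∃ (r : ℝ) (u v : V), y = r • a + u + v ∧ mul a u = 0 ∧ mul a v = (1 / 4 : ℝ) • v := by
  obtain ⟨r, u, v, w, rfl, hu, hv, hw⟩ := ha.exists_decomposition y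
  rw [hτ.apply_decomposition ha.idem hu hv hw] at hy
  have : w = 0 := eq_zero_of_eq_neg (by linear_combination (norm := module) -hy)
  exact ⟨r, u, v, by simp [this], hu, hv⟩

/-- The signs `e`, `f` are the `σ(a)`-eigenvalues of `u` and `v`. Multiplicativity of `τ(a)` removes
the `1/32`-part of `u · v`, and multiplicativity of `σ(a)` gives the last equation; the three fusion
rules below are its cases `e, f = ±1`. -/
theorem IsMajoranaAxis.exists_sigma (ha : IsMajoranaAxis mul form a) {u v : V}
    (hu : u ∈ plusSpace mul a) (hv : v ∈ plusSpace mul a) {e f : ℝ}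
    (hue : mul a u = 0 ∧ e = 1 ∨ mul a u = (1 / 4 : ℝ) • u ∧ e = -1)
    (hvf : mul a v = 0 ∧ f = 1 ∨ mul a v = (1 / 4 : ℝ) • v ∧ f = -1) :
    ∃ (r : ℝ) (x y : V), mul u v = r • a + x + y ∧ mul a x = 0 ∧ mul a y = (1 / 4 : ℝ) • y ∧
      (e * f) • (r • a + x + y) = r • a + x - y := by
  obtain ⟨τ, hτ, hτm⟩ := ha.tau_aut
  obtain ⟨σ, hσ, hσm⟩ := ha.sigma_aut
  have fixed : ∀ w : V, mul a w = 0 ∨ mul a w = (1 / 4 : ℝ) • w → τ w = w := by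
    rintro w (hw | hw)
    · exact hτ.zero w (mem_axisEigenspace.2 (by simpa using hw))
    · exact hτ.quarter w (mem_axisEigenspace.2 (by rw [hw]; norm_num))
  have scaled : ∀ (w : V) (hw : w ∈ plusSpace mul a) (g : ℝ),
      mul a w = 0 ∧ g = 1 ∨ mul a w = (1 / 4 : ℝ) • w ∧ g = -1 → (σ ⟨w, hw⟩ : V) = g • w := by
    rintro w hw g (⟨h, rfl⟩ | ⟨h, rfl⟩)
    · rw [hσ.zero ⟨w, hw⟩ (mem_axisEigenspace.2 (by simpa using h))]; simp
    · rw [hσ.quarter ⟨w, hw⟩ (mem_axisEigenspace.2 (by rw [h]; norm_num))]; simp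
  have hfix : τ (mul u v) = mul u v := by
    rw [← hτm, fixed u (by tauto), fixed v (by tauto)]
  obtain ⟨r, x, y, hxy, hx, hy⟩ := ha.exists_decomposition_of_fixed hτ hfix
  refine ⟨r, x, y, hxy, hx, hy, ?_⟩
  have hmem := mem_plusSpace_of_eq ha.idem hxy hx hy
  have key := hσm ⟨u, hu⟩ ⟨v, hv⟩ ⟨_, hmem⟩ rfl
  rw [scaled u hu e hue, scaled v hv f hvf] at key
  have ha' : a ∈ plusSpace mul a :=
    mem_plusSpace_of_eq (r := 1) (u := 0) (v := 0) ha.idem (by simp) (by simp) (by simp)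
  have hx' : x ∈ plusSpace mul a :=
    mem_plusSpace_of_eq (r := 0) (u := x) (v := 0) ha.idem (by simp) hx (by simp)
  have hy' : y ∈ plusSpace mul a :=
    mem_plusSpace_of_eq (r := 0) (u := 0) (v := y) ha.idem (by simp) (by simp) hy
  have split : (⟨mul u v, hmem⟩ : plusSpace mul a) = r • ⟨a, ha'⟩ + ⟨x, hx'⟩ + ⟨y, hy'⟩ :=
    Subtype.ext hxy
  rw [split, map_add, map_add, map_smul σ] at key
  simp only [Submodule.coe_add, Submodule.coe_smul] at key
  rw [scaled x hx' 1 (Or.inl ⟨hx, rfl⟩), scaled y hy' (-1) (Or.inr ⟨hy, rfl⟩),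
    hσ.one ⟨a, ha'⟩ (mem_axisEigenspace.2 (by simpa using ha.idem))] at key
  simp only [map_smul, LinearMap.smul_apply] at key
  rw [← hxy]
  linear_combination (norm := module) key

/-- Associativity of the form gives `μ (a, u) = (a, a·u) = (a·a, u) = (a, u)`. -/
theorem form_eq_zero_of_mul_eq_smul
    (hassoc : ∀ u v w, form u (mul v w) = form (mul u v) w)
    {μ : ℝ} (hμ : μ ≠ 1) {u : V} (ha : mul a a = a)
    (hu : mul a u = μ • u) : form a u = 0 := by
  have h := hassoc a a u
  rw [ha, hu, map_smul, smul_eq_mul] at h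
  have : (μ - 1) * form a u = 0 := by linarith
  exact (mul_eq_zero.1 this).resolve_left (sub_ne_zero.2 hμ)

/-- The fusion rule `V₀ V₀ ⊆ V₀`. -/
theorem IsMajoranaAxis.mul_zero_zero
    (hassoc : ∀ u v w, form u (mul v w) = form (mul u v) w)
    (ha : IsMajoranaAxis mul form a) {u v : V}
    (hu : mul a u = 0) (hv : mul a v = 0) : mul a (mul u v) = 0 := by
  obtain ⟨r, x, y, h, hx, hy, hs⟩ := ha.exists_sigma
    (mem_plusSpace_of_eq (r := 0) (u := u) (v := 0) ha.idem (by simp) hu (by simp))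
    (mem_plusSpace_of_eq (r := 0) (u := v) (v := 0) ha.idem (by simp) hv (by simp))
    (Or.inl ⟨hu, rfl⟩) (Or.inl ⟨hv, rfl⟩)
  have hy0 : y = 0 := eq_zero_of_eq_neg (by linear_combination (norm := module) hs)
  have hr : form a (mul u v) = r := by
    rw [h, hy0]
    simp [ha.length_one, form_eq_zero_of_mul_eq_smul hassoc (μ := 0) (by norm_num) ha.idem
      (show mul a x = (0 : ℝ) • x by simpa using hx)]
  have : r = 0 := by rw [← hr, hassoc, hu]; simp
  rw [h, hy0, this]; simp [hx]

/-- The fusion rule `V₀ V_{1/4} ⊆ V_{1/4}`. -/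
theorem IsMajoranaAxis.mul_zero_quarter (ha : IsMajoranaAxis mul form a) {u v : V}
    (hu : mul a u = 0) (hv : mul a v = (1 / 4 : ℝ) • v) :
    mul a (mul u v) = (1 / 4 : ℝ) • mul u v := by
  obtain ⟨r, x, y, h, hx, hy, hs⟩ := ha.exists_sigma
    (mem_plusSpace_of_eq (r := 0) (u := u) (v := 0) ha.idem (by simp) hu (by simp))
    (mem_plusSpace_of_eq (r := 0) (u := 0) (v := v) ha.idem (by simp) (by simp) hv)
    (Or.inl ⟨hu, rfl⟩) (Or.inr ⟨hv, rfl⟩)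
  have h0 : r • a + x = 0 := eq_zero_of_eq_neg (by linear_combination (norm := module) -hs)
  rw [h, h0, zero_add, hy]

/-- The fusion rule `V_{1/4} V_{1/4} ⊆ V₁ ⊕ V₀`. -/
theorem IsMajoranaAxis.mul_quarter_quarter
    (hassoc : ∀ u v w, form u (mul v w) = form (mul u v) w)
    (ha : IsMajoranaAxis mul form a) {u v : V}
    (hu : mul a u = (1 / 4 : ℝ) • u) (hv : mul a v = (1 / 4 : ℝ) • v) :
    mul a (mul u v) = form a (mul u v) • a := by
  obtain ⟨r, x, y, h, hx, hy, hs⟩ := ha.exists_sigma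
    (mem_plusSpace_of_eq (r := 0) (u := 0) (v := u) ha.idem (by simp) (by simp) hu)
    (mem_plusSpace_of_eq (r := 0) (u := 0) (v := v) ha.idem (by simp) (by simp) hv)
    (Or.inr ⟨hu, rfl⟩) (Or.inr ⟨hv, rfl⟩)
  have hy0 : y = 0 := eq_zero_of_eq_neg (by linear_combination (norm := module) hs)
  have hx0 := form_eq_zero_of_mul_eq_smul hassoc (μ := 0) (by norm_num) ha.idem
      (show mul a x = (0 : ℝ) • x by simpa using hx)
  rw [h, hy0]
  simp [ha.length_one, hx, hx0, ha.idem]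

/-- The projections of `y + τ(a) y` to the `0`- and `1/4`-eigenspaces of `a`, in terms of
`s = a · y - (a + y) / 32`. -/
theorem IsMajoranaAxis.neighbour
    (hassoc : ∀ u v w, form u (mul v w) = form (mul u v) w)
    (ha : IsMajoranaAxis mul form a) {τ : V →ₗ[ℝ] V}
    (hτ : IsTau mul a τ) {y y' s : V} {r : ℝ} (hy' : τ y = y')
    (hs : mul a y = s + (1 / 32 : ℝ) • (a + y)) (hr : form a y = r) :
    mul a y' = s + (1 / 32 : ℝ) • (a + y') ∧
    mul a ((7 / 16 : ℝ) • (y + y') - (4 : ℝ) • s + (3 * r - 1 / 8) • a) = 0 ∧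
    mul a ((4 : ℝ) • s + (1 / 8 - 4 * r) • a + (1 / 16 : ℝ) • (y + y')) =
      (1 / 4 : ℝ) • ((4 : ℝ) • s + (1 / 8 - 4 * r) • a + (1 / 16 : ℝ) • (y + y')) := by
  obtain ⟨q, u, v, w, rfl, hu, hv, hw⟩ := ha.exists_decomposition y
  rw [hτ.apply_decomposition ha.idem hu hv hw] at hy'
  have hq : q = r := by
    have h := hr
    simp only [map_add, map_smul, smul_eq_mul, ha.length_one] at h
    rw [form_eq_zero_of_mul_eq_smul hassoc (μ := 0) (by norm_num) ha.idem (by simpa using hu),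
      form_eq_zero_of_mul_eq_smul hassoc (by norm_num) ha.idem hv,
      form_eq_zero_of_mul_eq_smul hassoc (by norm_num) ha.idem hw] at h
    linarith
  subst hq hy'
  simp only [map_add, map_smul, ha.idem, hu, hv, hw] at hs
  -- Subtracting `(a + y) / 32` removes the `1/32`-part `w`, so `s` is the same for `y` and `y'`.
  -- The two combinations in the statement are exactly `u` and `v`.
  have hs' : s = (q - 1 / 32 - q / 32) • a - (1 / 32 : ℝ) • u + (7 / 32 : ℝ) • v := by
    linear_combination (norm := module) -hs
  subst hs'
  refine ⟨?_, ?_, ?_⟩ <;>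
  · simp only [map_add, map_sub, map_smul, ha.idem, hu, hv, hw]
    module

end AxisFusion

/-! ### Resurrection for commuting pairs and triangles of axes -/

section Dihedral

variable {V : Type*} [AddCommGroup V] [Module ℝ V]
  {mul : V →ₗ[ℝ] V →ₗ[ℝ] V} {form : V →ₗ[ℝ] V →ₗ[ℝ] ℝ}

theorem form_axis_mul (hassoc : ∀ u v w, form u (mul v w) = form (mul u v) w)
    {a : V} (ha : IsMajoranaAxis mul form a) (v : V) : form a (mul a v) = form a v := by
  rw [hassoc, ha.idem]

/-- A fixed `b` has no `1/32`-part: `b = (a, b) a + u + v` and `a·b = (a, b) a + v/4`. The two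
vectors are `u` and `v/4`. -/
theorem IsMajoranaAxis.fixed (hassoc : ∀ u v w, form u (mul v w) = form (mul u v) w)
    {a b : V} (ha : IsMajoranaAxis mul form a) {τ : V →ₗ[ℝ] V} (hτ : IsTau mul a τ)
    (hb : τ b = b) :
    mul a (b - (4 : ℝ) • mul a b + (3 * form a b) • a) = 0 ∧
    mul a (mul a b - form a b • a) = (1 / 4 : ℝ) • (mul a b - form a b • a) := by
  obtain ⟨-, hu, hv⟩ := ha.neighbour hassoc hτ hb
    (s := mul a b - (1 / 32 : ℝ) • (a + b)) (by module) rfl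
  constructor
  · rw [← hu]
    congr 1
    module
  · have e : mul a b - form a b • a = (1 / 4 : ℝ) • ((4 : ℝ) • (mul a b - (1 / 32 : ℝ) • (a + b)) +
      (1 / 8 - 4 * form a b) • a + (1 / 16 : ℝ) • (b + b)) := by module
    rw [e, map_smul, hv]

theorem IsMajoranaAxis.mul_mul_of_fixed
    (hassoc : ∀ u v w, form u (mul v w) = form (mul u v) w)
    {a b : V} (ha : IsMajoranaAxis mul form a) {τ : V →ₗ[ℝ] V} (hτ : IsTau mul a τ)
    (hb : τ b = b) :
    mul a (mul a b) = (1 / 4 : ℝ) • mul a b + (3 / 4 * form a b) • a := by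
  have h := (ha.fixed hassoc hτ hb).2
  simp only [map_sub, map_smul, ha.idem] at h
  linear_combination (norm := module) h

/-- Resurrection for two axes with commuting Majorana involutions. -/
theorem IsMajoranaAxis.smul_mul_of_commute
    (hcomm : ∀ u v, mul u v = mul v u)
    (hassoc : ∀ u v w, form u (mul v w) = form (mul u v) w)
    {a b : V} (ha : IsMajoranaAxis mul form a) (hbb : mul b b = b) {τ : V →ₗ[ℝ] V}
    (hτ : IsTau mul a τ) (hb : τ b = b)
    (hbp : mul b (mul a b) = (1 / 4 : ℝ) • mul a b + (3 / 4 * form a b) • b) :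
    ∃ κ : ℝ, (1 / 2 - 4 * form a b) • mul a b = κ • a := by
  obtain ⟨hu, hv⟩ := ha.fixed hassoc hτ hb
  have hap := ha.mul_mul_of_fixed hassoc hτ hb
  -- With `p = a·b`, the unknown `p·p` has coefficient 16 in the square of the `0`-vector and 1 in
  -- that of the `1/4`-vector, so `h1 - 16 h2` is free of it.
  have h1 := ha.mul_zero_zero hassoc hu hu
  have h2 := ha.mul_quarter_quarter hassoc hv hv
  generalize form a (mul _ _) = κ at h2
  have hba := hcomm b a
  have hpa := hcomm (mul a b) a
  have hpb := hcomm (mul a b) b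
  have haa := ha.idem
  generalize form a b = r at *
  generalize hp : mul a b = p at *
  refine ⟨-16 * κ - 5 * r ^ 2 + 3 / 2 * r, ?_⟩
  simp only [map_add, map_sub, map_smul, LinearMap.add_apply, LinearMap.sub_apply,
    LinearMap.smul_apply, haa, hbb, hp, hba, hpa, hpb, hap, hbp] at h1 h2
  linear_combination (norm := module) h1 - (16 : ℝ) • h2

/-- Fusion is applied to `u·u` and `u·v`, for the `0`- and `1/4`-vectors of `fixed`. With `p = a·b`,
the term `a·(p·p)` cancels in `h1/4 + h2`, while the eigenvalue side of `h2` retains `p·p`, which is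
thereby determined. This makes the third `2A` axis idempotent. -/
theorem IsMajoranaAxis.mul_self_of_commute
    (hcomm : ∀ u v, mul u v = mul v u)
    (hassoc : ∀ u v w, form u (mul v w) = form (mul u v) w)
    {a b : V} (ha : IsMajoranaAxis mul form a) (hbb : mul b b = b) {τ : V →ₗ[ℝ] V}
    (hτ : IsTau mul a τ) (hb : τ b = b) (hr : form a b = 1 / 8)
    (hbp : mul b (mul a b) = (1 / 4 : ℝ) • mul a b + (3 / 4 * form a b) • b) :
    mul (mul a b) (mul a b) = (3 / 128 : ℝ) • (a + b) - (1 / 32 : ℝ) • mul a b := by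
  obtain ⟨hu, hv⟩ := ha.fixed hassoc hτ hb
  have hap := ha.mul_mul_of_fixed hassoc hτ hb
  have h1 := ha.mul_zero_zero hassoc hu hu
  have h2 := ha.mul_zero_quarter hu hv
  have hba := hcomm b a
  have hpa := hcomm (mul a b) a
  have hpb := hcomm (mul a b) b
  have haa := ha.idem
  generalize hp : mul a b = p at *
  simp only [map_add, map_sub, map_smul, LinearMap.add_apply, LinearMap.sub_apply,
    LinearMap.smul_apply, haa, hbb, hp, hba, hpa, hpb, hap, hbp, hr] at h1 h2
  linear_combination (norm := module) (1 / 4 : ℝ) • h1 + h2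

/-- Two distinct axes with commuting Majorana involutions are either annihilating or generate
an algebra of type `2A`. -/
theorem IsMajoranaAxis.mul_eq_zero_or_isType2A
    (hcomm : ∀ u v, mul u v = mul v u) (hsymm : ∀ u v, form u v = form v u)
    (hassoc : ∀ u v w, form u (mul v w) = form (mul u v) w)
    {a b : V} (ha : IsMajoranaAxis mul form a) (hb : IsMajoranaAxis mul form b)
    {τ σ : V →ₗ[ℝ] V} (hτ : IsTau mul a τ) (hσ : IsTau mul b σ) (hτb : τ b = b) (hσa : σ a = a)
    (hab : a ≠ b) :
    mul a b = 0 ∨ IsType2A mul form a b (a + b - (8 : ℝ) • mul a b) := by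
  have hap := ha.mul_mul_of_fixed hassoc hτ hτb
  have hbp := hb.mul_mul_of_fixed hassoc hσ hσa
  have hba := hcomm b a
  have fab := form_axis_mul hassoc ha b
  have fba := form_axis_mul hassoc hb a
  by_cases hr : form a b = 1 / 8
  · right
    have hbp' : mul b (mul a b) = (1 / 4 : ℝ) • mul a b + (3 / 4 * form a b) • b := by
      rw [← hba, hbp, hsymm b a]
    have hpp := ha.mul_self_of_commute hcomm hassoc hb.idem hτ hτb hr hbp'
    have hpa := hcomm (mul a b) a
    have hpb := hcomm (mul a b) b
    have fpp : form (mul a b) (mul a b) = 11 / 256 := by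
      have e : form (mul a b) b = form a b := by rw [hsymm, ← hba, fba, hsymm]
      rw [hassoc, hcomm (mul a b) a, hap]
      simp only [map_add, map_smul, LinearMap.add_apply, LinearMap.smul_apply, smul_eq_mul, e, hr]
      norm_num
    rw [hba] at fba
    rw [hsymm b a] at fba
    have haa := ha.idem
    have hbb := hb.idem
    have l1 := ha.length_one
    have l2 := hb.length_one
    have fpa := hsymm (mul a b) a
    have fpb := hsymm (mul a b) b
    have fba' := hsymm b a
    rw [hr] at fab fba fba' hap hbp'
    generalize hp : mul a b = p at *
    have f1 : form a (a + b - (8 : ℝ) • p) = 1 / 2 ^ 3 := by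
      simp only [map_add, map_sub, map_smul, smul_eq_mul, fab, hr, l1]; norm_num
    have f2 : form b (a + b - (8 : ℝ) • p) = 1 / 2 ^ 3 := by
      simp only [map_add, map_sub, map_smul, smul_eq_mul, fba, fba', l2]; norm_num
    have f3 : form (a + b - (8 : ℝ) • p) (a + b - (8 : ℝ) • p) = 1 := by
      simp only [map_add, map_sub, map_smul, LinearMap.add_apply, LinearMap.sub_apply,
        LinearMap.smul_apply, smul_eq_mul, fab, fba, fpa, fpb, fba', hr, l1, l2, fpp]; norm_num
    have f1' := hsymm (a + b - (8 : ℝ) • p) a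
    have f2' := hsymm (a + b - (8 : ℝ) • p) b
    refine ⟨?_, haa, hbb, ?_, ?_, ?_, ?_, l1, l2, f3, by rw [hr]; norm_num, f1, f2⟩
    · rw [f1] at f1'
      rw [f2] at f2'
      generalize a + b - (8 : ℝ) • p = c at *
      rw [Fintype.linearIndependent_iff]
      intro g hg
      simp only [Fin.sum_univ_three, Matrix.cons_val] at hg
      have e1 := congrArg (form a) hg
      have e2 := congrArg (form b) hg
      have e3 := congrArg (form c) hg
      simp only [map_add, map_smul, smul_eq_mul, map_zero, l1, l2, f1, f2, f3, f1', f2', hr,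
        fba'] at e1 e2 e3
      intro i
      fin_cases i <;> simp <;> linarith
    · simp only [map_add, map_sub, map_smul, LinearMap.add_apply, LinearMap.sub_apply,
        LinearMap.smul_apply, haa, hbb, hp, hba, hpa, hpb, hap, hbp', hpp]
      module
    · rw [hp]
      module
    · simp only [map_add, map_sub, map_smul, haa, hp, hap]
      module
    · simp only [map_add, map_sub, map_smul, hbb, hba, hbp']
      module
  -- Away from `(a, b) = 1/8`, resurrection at both axes makes `a·b` a multiple of `a` and of `b`.
  -- As `a ≠ b`, this forces `(a, b) = 0` and then `a·b = 0`.
  · left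
    obtain ⟨κ, hκ⟩ := ha.smul_mul_of_commute hcomm hassoc hb.idem hτ hτb
      (by rw [← hba, hbp, hsymm b a])
    obtain ⟨κ', hκ'⟩ := hb.smul_mul_of_commute hcomm hassoc ha.idem hσ hσa
      (by rw [hba, hap, hsymm a b])
    have g1 := congrArg (form a) hκ
    have g2 := congrArg (form b) hκ'
    simp only [map_smul, smul_eq_mul, fab, fba, ha.length_one, hb.length_one] at g1 g2
    rw [hba, hsymm b a] at hκ'
    rw [hsymm b a] at g2
    have hs : (1 / 2 - 4 * form a b) ≠ 0 := fun h => hr (by linarith)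
    have e : ((1 / 2 - 4 * form a b) * form a b) • (a - b) = 0 := by
      rw [smul_sub, g1, mul_one]
      rw [show κ = κ' by linarith] at hκ ⊢
      rw [← hκ, ← hκ', sub_self]
    have hr0 : form a b = 0 := by
      rcases smul_eq_zero.1 e with h | h
      · exact (mul_eq_zero.1 h).resolve_left hs
      · exact absurd (sub_eq_zero.1 h) hab
    rw [hr0] at g1
    rw [show κ = 0 by linarith, zero_smul] at hκ
    exact (smul_eq_zero.1 hκ).resolve_left hs

/-- The resurrection relation in a dihedral algebra whose three axes are conjugate. -/
theorem IsMajoranaAxis.triple_relation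
    (hcomm : ∀ u v, mul u v = mul v u)
    (hassoc : ∀ u v w, form u (mul v w) = form (mul u v) w)
    {x y z s : V} {r : ℝ} (hx : IsMajoranaAxis mul form x)
    (hyy : mul y y = y) (hzz : mul z z = z)
    (hxy : mul x y = s + (1 / 32 : ℝ) • (x + y)) (hxz : mul x z = s + (1 / 32 : ℝ) • (x + z))
    (hyz : mul y z = s + (1 / 32 : ℝ) • (y + z))
    (fxy : form x y = r) (fxz : form x z = r)
    (hxs : mul x ((7 / 16 : ℝ) • (y + z) - (4 : ℝ) • s + (3 * r - 1 / 8) • x) = 0)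
    (hys : mul y ((7 / 16 : ℝ) • (z + x) - (4 : ℝ) • s + (3 * r - 1 / 8) • y) = 0)
    (hzs : mul z ((7 / 16 : ℝ) • (x + y) - (4 : ℝ) • s + (3 * r - 1 / 8) • z) = 0)
    (hv : mul x ((4 : ℝ) • s + (1 / 8 - 4 * r) • x + (1 / 16 : ℝ) • (y + z)) =
      (1 / 4 : ℝ) • ((4 : ℝ) • s + (1 / 8 - 4 * r) • x + (1 / 16 : ℝ) • (y + z))) :
    (13 / 256 - r) • ((4 : ℝ) • s + (1 / 16 : ℝ) • (y + z) - ((32 * r - 1) / 8) • x) = 0 := by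
  have h1 := hx.mul_zero_zero hassoc hxs hxs
  have h2 := hx.mul_quarter_quarter hassoc hv hv
  generalize form x (mul _ _) = κ at h2
  have fs : form x s = (31 * r - 1) / 32 := by
    have h := form_axis_mul hassoc hx y
    rw [hxy] at h
    simp only [map_add, map_smul, smul_eq_mul, hx.length_one, fxy] at h
    linarith
  have hxx := hx.idem
  have hyx := hcomm y x
  have hzx := hcomm z x
  have hzy := hcomm z y
  have hsx := hcomm s x
  have hsy := hcomm s y
  have hsz := hcomm s z
  have hxs' : mul x s = (7 / 64 : ℝ) • ((2 : ℝ) • s + (1 / 16 : ℝ) • x + (1 / 32 : ℝ) • (y + z)) +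
      ((3 * r - 1 / 8) / 4) • x := by
    simp only [map_add, map_sub, map_smul, hxx, hxy, hxz] at hxs
    linear_combination (norm := module) (-1 / 4 : ℝ) • hxs
  have hys' : mul y s = (7 / 64 : ℝ) • ((2 : ℝ) • s + (1 / 16 : ℝ) • y + (1 / 32 : ℝ) • (z + x)) +
      ((3 * r - 1 / 8) / 4) • y := by
    simp only [map_add, map_sub, map_smul, hyy, hyx, hxy, hyz] at hys
    linear_combination (norm := module) (-1 / 4 : ℝ) • hys
  have hzs' : mul z s = (7 / 64 : ℝ) • ((2 : ℝ) • s + (1 / 16 : ℝ) • z + (1 / 32 : ℝ) • (x + y)) +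
      ((3 * r - 1 / 8) / 4) • z := by
    simp only [map_add, map_sub, map_smul, hzz, hzx, hxz, hzy, hyz] at hzs
    linear_combination (norm := module) (-1 / 4 : ℝ) • hzs
  simp only [map_add, map_sub, map_smul, LinearMap.add_apply, LinearMap.sub_apply,
    LinearMap.smul_apply, hxx, hyy, hzz, hyx, hzx, hzy, hsx, hsy, hsz, hxy, hxz, hyz,
    hxs', hys', hzs'] at h1 h2
  -- Both squares contain `16 s·s`, so `h1 - h2` removes `x·(s·s)`. The witness merely collects the
  -- coefficients of `x`; pairing with `x` below evaluates it as a function of `r`.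
  obtain ⟨C, hC⟩ : ∃ C : ℝ, (13 / 256 - r) • ((4 : ℝ) • s + (1 / 16 : ℝ) • (y + z)) = C • x := by
    refine ⟨-κ - ((143 / 512 - 23 / 8 * r) / 16 + (8 * r - 13 / 8) * (3 * r / 4 - 25 / 1024) +
      (-7 / 256 + (7 * r - 1 / 4) / 32 - r * (3 / 128) + 8 * r * (3 * r / 4 - 25 / 1024) -
        r * (7 * r - 1 / 4))), ?_⟩
    linear_combination (norm := module) h1 - h2
  have g := congrArg (form x) hC
  simp only [map_add, map_smul, smul_eq_mul, fs, fxy, fxz, hx.length_one] at g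
  rw [smul_sub, hC, ← smul_assoc, smul_eq_mul, ← sub_smul]
  rw [show C - (13 / 256 - r) * ((32 * r - 1) / 8) = 0 by linarith, zero_smul]

/-- The vector `s` is common to the three pairs, so `triple_relation` holds at each axis. Unless `r
= 13/256`, the relations at `x` and `y` both determine `4s`, and comparing them gives `r = 1/64`.
These are the inner products of types `3A` and `3C`. -/
theorem form_eq_of_triple
    (hcomm : ∀ u v, mul u v = mul v u) (hsymm : ∀ u v, form u v = form v u)
    (hassoc : ∀ u v w, form u (mul v w) = form (mul u v) w)
    {x y z : V} {r : ℝ} (hx : IsMajoranaAxis mul form x) (hy : IsMajoranaAxis mul form y)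
    (hz : IsMajoranaAxis mul form z) {τx τy τz : V →ₗ[ℝ] V} (hτx : IsTau mul x τx)
    (hτy : IsTau mul y τy) (hτz : IsTau mul z τz)
    (hxy : τx y = z) (hyz : τy z = x) (hzx : τz x = y)
    (fxy : form x y = r) (fyz : form y z = r) (fzx : form z x = r) (hne : x ≠ y) :
    r = 13 / 256 ∨ r = 1 / 64 := by
  obtain ⟨s, hs⟩ : ∃ s, mul x y = s + (1 / 32 : ℝ) • (x + y) :=
    ⟨mul x y - (1 / 32 : ℝ) • (x + y), by module⟩
  obtain ⟨mxz, ux, vx⟩ := hx.neighbour hassoc hτx hxy hs fxy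
  have hs' : mul z x = s + (1 / 32 : ℝ) • (z + x) := by rw [hcomm, mxz, add_comm x z]
  obtain ⟨mzy, uz, vz⟩ := hz.neighbour hassoc hτz hzx hs' fzx
  have hs'' : mul y z = s + (1 / 32 : ℝ) • (y + z) := by rw [hcomm, mzy, add_comm y z]
  obtain ⟨myx, uy, vy⟩ := hy.neighbour hassoc hτy hyz hs'' fyz
  have R1 := hx.triple_relation hcomm hassoc hy.idem hz.idem hs mxz hs'' fxy
    (by rw [hsymm, fzx]) ux uy uz vx
  have R2 := hy.triple_relation hcomm hassoc hz.idem hx.idem hs'' myx hs' fyz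
    (by rw [hsymm, fxy]) uy uz ux vy
  by_cases h : r = 13 / 256
  · exact Or.inl h
  · have h' : (13 / 256 - r : ℝ) ≠ 0 := fun h0 => h (by linarith)
    have e1 := (smul_eq_zero.1 R1).resolve_left h'
    have e2 := (smul_eq_zero.1 R2).resolve_left h'
    have e3 : (1 / 16 + (32 * r - 1) / 8) • (x - y) = 0 := by
      linear_combination (norm := module) e2 - e1
    have := (smul_eq_zero.1 e3).resolve_right (sub_ne_zero.2 hne)
    exact Or.inr (by linarith)

end Dihedral

/-! ### Hexagons of axes -/

section Sextuple

variable {V : Type*} [AddCommGroup V] [Module ℝ V]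
  {mul : V →ₗ[ℝ] V →ₗ[ℝ] V} {form : V →ₗ[ℝ] V →ₗ[ℝ] ℝ}

/-- The resurrection relation for six axes forming a hexagon in which opposite axes annihilate
each other. -/
theorem IsMajoranaAxis.sextuple_relation
    (hcomm : ∀ u v, mul u v = mul v u)
    (hassoc : ∀ u v w, form u (mul v w) = form (mul u v) w)
    {x₀ x₁ x₂ x₃ x₄ x₅ s e o : V} {r : ℝ} (h₀ : IsMajoranaAxis mul form x₀)
    (h₃₃ : mul x₃ x₃ = x₃) (h₀₃ : mul x₀ x₃ = 0)
    (h₀₁ : mul x₀ x₁ = s + (1 / 32 : ℝ) • (x₀ + x₁))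
    (h₀₅ : mul x₀ x₅ = s + (1 / 32 : ℝ) • (x₀ + x₅))
    (h₃₂ : mul x₃ x₂ = s + (1 / 32 : ℝ) • (x₃ + x₂))
    (h₃₄ : mul x₃ x₄ = s + (1 / 32 : ℝ) • (x₃ + x₄))
    (h₀₂ : mul x₀ x₂ = e + (1 / 32 : ℝ) • (x₀ + x₂))
    (h₀₄ : mul x₀ x₄ = e + (1 / 32 : ℝ) • (x₀ + x₄))
    (h₃₁ : mul x₃ x₁ = o + (1 / 32 : ℝ) • (x₃ + x₁))
    (h₃₅ : mul x₃ x₅ = o + (1 / 32 : ℝ) • (x₃ + x₅))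
    (hu : mul x₀ ((7 / 16 : ℝ) • (x₁ + x₅) - (4 : ℝ) • s + (3 * r - 1 / 8) • x₀) = 0)
    (hv : mul x₀ ((4 : ℝ) • s + (1 / 8 - 4 * r) • x₀ + (1 / 16 : ℝ) • (x₁ + x₅)) =
      (1 / 4 : ℝ) • ((4 : ℝ) • s + (1 / 8 - 4 * r) • x₀ + (1 / 16 : ℝ) • (x₁ + x₅)))
    (hu₃ : mul x₃ ((7 / 16 : ℝ) • (x₂ + x₄) - (4 : ℝ) • s + (3 * r - 1 / 8) • x₃) = 0) :
    (1 / 32 : ℝ) • (e - o) + (3 / 1024 : ℝ) • (x₁ + x₅ - x₂ - x₄) +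
      (3 / 4 * (r - 1 / 32)) • (x₀ - x₃) = 0 := by
  -- Since `x₃` lies in the `0`-space of `x₀`, multiplying by it preserves the `0`- and
  -- `1/4`-spaces. The unknown `x₀·o` enters `h1` with coefficient 7/8 and `h2` with 1/8, whence the
  -- combination `h2 - h1/7`.
  have h1 := h₀.mul_zero_zero hassoc h₀₃ hu
  have h2 := h₀.mul_zero_quarter h₀₃ hv
  have h₃₀ := hcomm x₃ x₀
  have hs₃ : mul x₃ s = (7 / 64 : ℝ) •
      ((2 : ℝ) • s + (1 / 16 : ℝ) • x₃ + (1 / 32 : ℝ) • (x₂ + x₄)) +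
      ((3 * r - 1 / 8) / 4) • x₃ := by
    simp only [map_add, map_sub, map_smul, h₃₃, h₃₂, h₃₄] at hu₃
    linear_combination (norm := module) (-1 / 4 : ℝ) • hu₃
  have hs₀ : mul x₀ s = (7 / 64 : ℝ) •
      ((2 : ℝ) • s + (1 / 16 : ℝ) • x₀ + (1 / 32 : ℝ) • (x₁ + x₅)) +
      ((3 * r - 1 / 8) / 4) • x₀ := by
    simp only [map_add, map_sub, map_smul, h₀.idem, h₀₁, h₀₅] at hu
    linear_combination (norm := module) (-1 / 4 : ℝ) • hu
  simp only [map_add, map_sub, map_smul, h₃₁, h₃₅, h₃₀, h₀₃, hs₃, hs₀, h₀₁, h₀₂, h₀₄, h₀₅,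
    smul_zero, add_zero] at h1 h2
  linear_combination (norm := module) h2 - (1 / 7 : ℝ) • h1

/-- A hexagon of axes cannot have annihilating opposite axes. -/
theorem mul_opposite_ne_zero
    (hcomm : ∀ u v, mul u v = mul v u) (hsymm : ∀ u v, form u v = form v u)
    (hassoc : ∀ u v w, form u (mul v w) = form (mul u v) w)
    {x : ZMod 6 → V} {τ : ZMod 6 → V →ₗ[ℝ] V} (hx : ∀ i, IsMajoranaAxis mul form (x i))
    (hτ : ∀ i, IsTau mul (x i) (τ i)) (hτx : ∀ i j, τ i (x j) = x (2 * i - j))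
    (hτf : ∀ i u v, form (τ i u) (τ i v) = form u v)
    (hτm : ∀ i u v, mul (τ i u) (τ i v) = τ i (mul u v)) (hne : x 0 ≠ x 2) :
    mul (x 0) (x 3) ≠ 0 := by
  intro h₀₃
  have act : ∀ i j k l m, 2 * i - j = l → 2 * i - k = m → form (x j) (x k) = form (x l) (x m) := by
    rintro i j k l m rfl rfl
    rw [← hτf i, hτx, hτx]
  have h₅₂ : mul (x 5) (x 2) = 0 := by
    have := hτm 1 (x 3) (x 0)
    rw [hτx, hτx, hcomm (x 3), h₀₃, map_zero] at this
    exact this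
  have t01 := hτx 0 1
  have t54 := hτx 5 0
  have t42 := hτx 4 5
  have t32 := hτx 3 4
  have t02 := hτx 0 2
  have t31 := hτx 3 1
  have t24 := hτx 2 4
  have t40 := hτx 4 0
  obtain ⟨r, hr⟩ : ∃ r, form (x 0) (x 1) = r := ⟨_, rfl⟩
  obtain ⟨q, hq⟩ : ∃ q, form (x 0) (x 2) = q := ⟨_, rfl⟩
  have f05 : form (x 0) (x 5) = r := by rw [← hr]; exact act 0 _ _ _ _ (by decide) (by decide)
  have f50 : form (x 5) (x 0) = r := by rw [hsymm, f05]
  have f12 : form (x 1) (x 2) = r := by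
    rw [← hr, hsymm (x 0)]; exact act 1 _ _ _ _ (by decide) (by decide)
  have f21 : form (x 2) (x 1) = r := by rw [hsymm, f12]
  have f45 : form (x 4) (x 5) = r := by
    rw [← f50]; exact act 5 _ _ _ _ (by decide) (by decide) |>.trans (hsymm _ _)
  have f23 : form (x 2) (x 3) = r := by
    rw [← f21]; exact act 2 _ _ _ _ (by decide) (by decide)
  have f34 : form (x 3) (x 4) = r := by
    rw [← f23, hsymm (x 2)]; exact act 3 _ _ _ _ (by decide) (by decide)
  have f04 : form (x 0) (x 4) = q := by rw [← hq]; exact act 0 _ _ _ _ (by decide) (by decide)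
  have f24 : form (x 2) (x 4) = q := by
    rw [← hq, hsymm (x 0)]; exact act 2 _ _ _ _ (by decide) (by decide)
  obtain ⟨s, hs⟩ : ∃ s, mul (x 0) (x 1) = s + (1 / 32 : ℝ) • (x 0 + x 1) :=
    ⟨mul (x 0) (x 1) - (1 / 32 : ℝ) • (x 0 + x 1), by module⟩
  obtain ⟨e, he⟩ : ∃ s, mul (x 0) (x 2) = s + (1 / 32 : ℝ) • (x 0 + x 2) :=
    ⟨mul (x 0) (x 2) - (1 / 32 : ℝ) • (x 0 + x 2), by module⟩
  obtain ⟨o, ho⟩ : ∃ s, mul (x 3) (x 1) = s + (1 / 32 : ℝ) • (x 3 + x 1) :=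
    ⟨mul (x 3) (x 1) - (1 / 32 : ℝ) • (x 3 + x 1), by module⟩
  obtain ⟨h05, u0, v0⟩ := (hx 0).neighbour hassoc (hτ 0) (t01.trans (congrArg x (show (_ : ZMod 6) = 5 by decide))) hs hr
  obtain ⟨h54, -, -⟩ := (hx 5).neighbour hassoc (hτ 5) (t54.trans (congrArg x (show (_ : ZMod 6) = 4 by decide)))
    (by rw [hcomm, h05, add_comm (x 0)]) f50
  obtain ⟨h43, -, -⟩ := (hx 4).neighbour hassoc (hτ 4) (t42.trans (congrArg x (show (_ : ZMod 6) = 3 by decide)))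
    (by rw [hcomm, h54, add_comm (x 5)]) f45
  have h34 : mul (x 3) (x 4) = s + (1 / 32 : ℝ) • (x 3 + x 4) := by
    rw [hcomm, h43, add_comm (x 4)]
  obtain ⟨h32, u3, -⟩ := (hx 3).neighbour hassoc (hτ 3) (t32.trans (congrArg x (show (_ : ZMod 6) = 2 by decide)))
    h34 f34
  obtain ⟨h04, -, -⟩ := (hx 0).neighbour hassoc (hτ 0) (t02.trans (congrArg x (show (_ : ZMod 6) = 4 by decide)))
    he hq
  obtain ⟨h35, -, -⟩ := (hx 3).neighbour hassoc (hτ 3) (t31.trans (congrArg x (show (_ : ZMod 6) = 5 by decide)))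
    ho rfl
  have R := (hx 0).sextuple_relation hcomm hassoc (hx 3).idem h₀₃ hs h05 h32 h34 he h04 ho h35 u0 v0
    (by rw [add_comm (x 2)]; exact u3)
  -- The even axes form a triangle, so `q` has only two possible values. Pairing `R` with `x 0`
  -- gives `q = 1 - 31 r`, and pairing with `x 2` then excludes both values.
  have hq' := form_eq_of_triple hcomm hsymm hassoc (hx 0) (hx 2) (hx 4) (hτ 0) (hτ 2) (hτ 4)
    (t02.trans (congrArg x (show (_ : ZMod 6) = 4 by decide))) (t24.trans (congrArg x (show (_ : ZMod 6) = 0 by decide)))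
    ((hτx 4 0).trans (congrArg x (show (_ : ZMod 6) = 2 by decide))) hq f24 (by rw [hsymm, f04]) hne
  have f03 : form (x 0) (x 3) = 0 := by
    rw [← form_axis_mul hassoc (hx 0), h₀₃, map_zero]
  have f25 : form (x 2) (x 5) = 0 := by
    rw [← form_axis_mul hassoc (hx 2), hcomm, h₅₂, map_zero]
  have f0e : form (x 0) e = (31 * q - 1) / 32 := by
    have h := form_axis_mul hassoc (hx 0) (x 2)
    rw [he] at h
    simp only [map_add, map_smul, smul_eq_mul, (hx 0).length_one, hq] at h
    linarith
  have f2e : form (x 2) e = (31 * q - 1) / 32 := by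
    have h := form_axis_mul hassoc (hx 2) (x 0)
    rw [hcomm, he] at h
    simp only [map_add, map_smul, smul_eq_mul, (hx 2).length_one, hsymm (x 2) (x 0), hq] at h
    linarith
  have f0o : form (x 0) o = -r / 32 := by
    have h := hassoc (x 0) (x 3) (x 1)
    rw [h₀₃, ho] at h
    simp only [map_add, map_smul, smul_eq_mul, f03, hr, map_zero, LinearMap.zero_apply] at h
    linarith
  have f2o : form (x 2) o = -r / 32 := by
    have h := hassoc (x 2) (x 5) (x 3)
    rw [hcomm (x 2), h₅₂, hcomm, h35] at h
    simp only [map_add, map_smul, smul_eq_mul, f23, f25, map_zero, LinearMap.zero_apply] at h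
    linarith
  have g0 := congrArg (form (x 0)) R
  have g2 := congrArg (form (x 2)) R
  simp only [map_add, map_sub, map_smul, smul_eq_mul, map_zero, (hx 0).length_one,
    (hx 2).length_one, f0e, f2e, f0o, f2o, hr, hq, f05, f04, f03, f21, f25, f24, f23,
    hsymm (x 2) (x 0)] at g0 g2
  have hqr : q = 1 - 31 * r := by linarith
  rw [hqr] at hq' g2
  rcases hq' with h | h
  · rw [show r = 243 / 7936 by linarith] at g2
    norm_num at g2
  · rw [show r = 63 / 1984 by linarith] at g2
    norm_num at g2

end Sextuple

/-! ### Cubes of products of order 6, and pure subgroups `2³` -/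

namespace MajoranaRepresentation

variable {G : Type*} [Group G] {T : Set G} {V : Type*} [AddCommGroup V] [Module ℝ V]

theorem φ_ψ (R : MajoranaRepresentation G T V) {g t t' : G} (ht : t ∈ T) (ht' : t' ∈ T)
    (h : g * t * g⁻¹ = t') : R.φ g (R.ψ ⟨t, ht⟩) = R.ψ ⟨t', ht'⟩ := by
  subst h
  exact (R.ψ_conj ⟨t, ht⟩ g).symm

theorem mul_self (R : MajoranaRepresentation G T V) {t : G} (ht : t ∈ T) : t * t = 1 := by
  rw [← pow_two, ← R.involution t ht, pow_orderOf_eq_one]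

/-- If `t, s ∈ T` and `ts` has order `6`, then the axes of `t` and of the opposite reflection
generate an algebra of type `2A`, so that `(ts)³ ∈ T`. -/
theorem pow_three_mem (R : MajoranaRepresentation G T V) {t s : G} (ht : t ∈ T) (hs : s ∈ T)
    (h : orderOf (t * s) = 6) : (t * s) ^ 3 ∈ T := by
  have tt := R.mul_self ht
  have ti : t⁻¹ = t := inv_eq_of_mul_eq_one_left tt
  have si : s⁻¹ = s := inv_eq_of_mul_eq_one_left (R.mul_self hs)
  generalize hρ : t * s = ρ at *
  have hs' : ρ⁻¹ * t = s := by
    rw [← hρ, mul_inv_rev, ti, si, mul_assoc, tt, mul_one]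
  have htρ : t * ρ * t⁻¹ = ρ⁻¹ := by
    rw [← hρ, mul_inv_rev, ti, si, ← mul_assoc, tt, one_mul]
  have htz : ∀ i : ℤ, t * ρ ^ i = ρ ^ (-i) * t := by
    intro i
    have h1 : t * ρ ^ i * t⁻¹ = ρ ^ (-i) := by rw [← conj_zpow, htρ, inv_zpow, zpow_neg]
    rw [← h1, inv_mul_cancel_right]
  have hper : ∀ i j : ℤ, (i : ZMod 6) = j ↔ ρ ^ i = ρ ^ j := by
    intro i j
    rw [zpow_eq_zpow_iff_modEq, h, ← ZMod.intCast_eq_intCast_iff]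
  -- The six reflections `ρ^i t`; `t` and `s` are the neighbours `d 0` and `d 5`, and `d 0 * d 3` is
  -- the central rotation `ρ³`.
  obtain ⟨d, hd⟩ : ∃ d : ZMod 6 → G, ∀ i : ℤ, d i = ρ ^ i * t := by
    refine ⟨fun i => ρ ^ (i.cast : ℤ) * t, fun i => ?_⟩
    change ρ ^ ((i : ZMod 6).cast : ℤ) * t = ρ ^ i * t
    rw [(hper _ i).1 (ZMod.intCast_zmod_cast _)]
  have d0 : d 0 = t := by simpa using hd 0
  have d5 : d 5 = s := by
    have := hd (-1)
    rw [zpow_neg_one, hs'] at this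
    rw [← this]; rfl
  have conj_rule : ∀ i j : ZMod 6, d i * d j * (d i)⁻¹ = d (2 * i - j) := by
    intro i j
    obtain ⟨i, rfl⟩ := ZMod.intCast_surjective i
    obtain ⟨j, rfl⟩ := ZMod.intCast_surjective j
    have e : (2 * (i : ZMod 6) - j) = ((2 * i - j : ℤ) : ZMod 6) := by push_cast; rfl
    rw [e, hd, hd, hd, mul_inv_rev, ti]
    calc ρ ^ i * t * (ρ ^ j * t) * (t * (ρ ^ i)⁻¹) = ρ ^ i * (t * ρ ^ j) * (t * t) * (ρ ^ i)⁻¹ := by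
          simp only [mul_assoc]
      _ = ρ ^ i * ρ ^ (-j) * (t * ρ ^ (-i)) := by
          rw [tt, mul_one, htz, zpow_neg ρ i]; simp only [mul_assoc]
      _ = ρ ^ (2 * i - j) * t := by
          rw [htz, neg_neg, ← mul_assoc, ← zpow_add, ← zpow_add]
          congr 2; ring
  have step : ∀ i j k : ZMod 6, 2 * i - j = k → d j ∈ T → d k ∈ T := by
    rintro i j k rfl hj
    rw [← conj_rule]
    exact R.stable _ hj _
  have m0 : d 0 ∈ T := d0 ▸ ht
  have m5 : d 5 ∈ T := d5 ▸ hs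
  have hT : ∀ i, d i ∈ T := by
    have m1 := step 0 5 1 (by decide) m5
    have m4 := step 5 0 4 (by decide) m0
    have m2 := step 0 4 2 (by decide) m4
    have m3 := step 4 5 3 (by decide) m5
    intro i
    fin_cases i
    exacts [m0, m1, m2, m3, m4, m5]
  have hact : ∀ i j k, 2 * i - j = k →
      (R.φ (d i) : V →ₗ[ℝ] V) (R.ψ ⟨d j, hT j⟩) = R.ψ ⟨d k, hT k⟩ := by
    rintro i j k rfl
    exact R.φ_ψ (hT j) (hT _) (conj_rule i j)
  have hinj : ∀ i j : ℤ, (i : ZMod 6) ≠ j → R.ψ ⟨d i, hT i⟩ ≠ R.ψ ⟨d j, hT j⟩ := by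
    intro i j hij he
    have := congrArg Subtype.val (R.ψ_injective he)
    simp only [hd] at this
    exact hij ((hper i j).2 (mul_right_cancel this))
  have hne := mul_opposite_ne_zero R.mul_comm R.form_symm R.assoc
    (x := fun i => R.ψ ⟨d i, hT i⟩) (τ := fun i => (R.φ (d i) : V →ₗ[ℝ] V))
    (fun i => R.axis _) (fun i => R.φ_eq_tau ⟨d i, hT i⟩) (fun i j => hact i j _ rfl)
    (fun i u v => R.φ_form _ u v) (fun i u v => (R.φ_mul _ u v).symm)
    (by have := hinj 0 2 (by decide); exact_mod_cast this)
  rcases (R.axis ⟨d 0, hT 0⟩).mul_eq_zero_or_isType2A R.mul_comm R.form_symm R.assoc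
    (R.axis ⟨d 3, hT 3⟩) (R.φ_eq_tau ⟨d 0, hT 0⟩) (R.φ_eq_tau ⟨d 3, hT 3⟩)
    (hact 0 3 3 (by decide)) (hact 3 0 0 (by decide))
    (by have := hinj 0 3 (by decide); exact_mod_cast this) with h0 | h2A
  · exact absurd h0 hne
  · obtain ⟨hm, -⟩ := R.mem_of_type2A _ _ _ h2A
    have e : d 0 * d 3 = ρ ^ 3 := by
      have h3 := hd 3
      rw [show ((3 : ℤ) : ZMod 6) = 3 from rfl] at h3
      rw [d0, h3, ← mul_assoc, htz, mul_assoc, tt, mul_one]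
      have := (hper (-3) 3).1 (by decide)
      rw [this]; exact zpow_natCast ρ 3
    rwa [← e]

/-- There are no `2A`-pure elementary abelian subgroups of order `8`. -/
theorem false_of_pure (R : MajoranaRepresentation G T V) {t s r : G} (ht : t ∈ T) (hs : s ∈ T)
    (hr : r ∈ T) (hts : s * t ∈ T) (htr : r * t ∈ T) (hsr : s * r ∈ T) (htsr : s * r * t ∈ T)
    (cts : t * s = s * t) (ctr : t * r = r * t) (csr : s * r = r * s) : False := by
  have tt := R.mul_self ht
  have ss := R.mul_self hs
  have rr := R.mul_self hr
  have prod : ∀ {x y z : G} (hx : x ∈ T) (hy : y ∈ T) (hz : z ∈ T), x * y * z = 1 →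
      R.mul (R.ψ ⟨x, hx⟩) (R.ψ ⟨y, hy⟩) =
        (1 / 8 : ℝ) • (R.ψ ⟨x, hx⟩ + R.ψ ⟨y, hy⟩ - R.ψ ⟨z, hz⟩) := by
    intro x y z hx hy hz h
    have := (R.type2A_of_mul ⟨x, hx⟩ ⟨y, hy⟩ ⟨z, hz⟩ h).mul₀₁
    norm_num at this ⊢
    exact this
  have t' : ∀ x : G, t * (t * x) = x := fun x => by rw [← mul_assoc, tt, one_mul]
  have s' : ∀ x : G, s * (s * x) = x := fun x => by rw [← mul_assoc, ss, one_mul]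
  have r' : ∀ x : G, r * (r * x) = x := fun x => by rw [← mul_assoc, rr, one_mul]
  have cts' : ∀ x : G, t * (s * x) = s * (t * x) := fun x => by
    rw [← mul_assoc, cts, mul_assoc]
  have ctr' : ∀ x : G, t * (r * x) = r * (t * x) := fun x => by
    rw [← mul_assoc, ctr, mul_assoc]
  have crs : r * s = s * r := csr.symm
  have crs' : ∀ x : G, r * (s * x) = s * (r * x) := fun x => by
    rw [← mul_assoc, crs, mul_assoc]
  obtain ⟨e1, e2, e3, e4, e5, e6, e7, e8, e9, e10⟩ : t * s * (s * t) = 1 ∧ t * (s * t) * s = 1 ∧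
      t * r * (r * t) = 1 ∧ t * (r * t) * r = 1 ∧ s * r * (s * r) = 1 ∧
      s * (r * t) * (s * r * t) = 1 ∧ s * t * r * (s * r * t) = 1 ∧
      s * t * (r * t) * (s * r) = 1 ∧ t * (s * r) * (s * r * t) = 1 ∧
      t * (s * r * t) * (s * r) = 1 := by
    refine ⟨?_, ?_, ?_, ?_, ?_, ?_, ?_, ?_, ?_, ?_⟩ <;>
    simp only [mul_assoc, cts, ctr, cts', ctr', crs', tt, ss, rr, mul_one]
  have p1 := prod ht hs hts e1
  have p2 := prod ht hts hs e2
  have p3 := prod ht hr htr e3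
  have p4 := prod ht htr hr e4
  have q1 := prod hs hr hsr e5
  have q2 := prod hs htr htsr e6
  have q3 := prod hts hr htsr e7
  have q4 := prod hts htr hsr e8
  have u1 := prod ht hsr htsr e9
  have u2 := prod ht htsr hsr e10
  have hneq : R.ψ ⟨s * r, hsr⟩ ≠ R.ψ ⟨s * r * t, htsr⟩ := by
    intro he
    have h1 : t = 1 := by simpa using congrArg Subtype.val (R.ψ_injective he)
    have := R.involution t ht
    rw [h1, orderOf_one] at this
    norm_num at this
  have ha := R.axis ⟨t, ht⟩
  generalize R.ψ ⟨t, ht⟩ = a at *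
  generalize R.ψ ⟨s, hs⟩ = b at *
  generalize R.ψ ⟨s * t, hts⟩ = ab at *
  generalize R.ψ ⟨r, hr⟩ = c at *
  generalize R.ψ ⟨r * t, htr⟩ = ac at *
  generalize R.ψ ⟨s * r, hsr⟩ = bc at *
  generalize R.ψ ⟨s * r * t, htsr⟩ = abc at *
  -- The vectors `b - ab`, `c - ac` and `bc - abc` are all `1/4`-eigenvectors of `a`, and the
  -- product of the first two is `-1/4` times the third. Fusion and orthogonality to `a` force the
  -- third to vanish.
  have h := ha.mul_quarter_quarter R.assoc (u := b - ab) (v := c - ac)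
    (by rw [map_sub, p1, p2]; module) (by rw [map_sub, p3, p4]; module)
  have e : R.mul (b - ab) (c - ac) = (-1 / 4 : ℝ) • (bc - abc) := by
    simp only [map_sub, LinearMap.sub_apply, q1, q2, q3, q4]
    module
  have q : R.mul a (bc - abc) = (1 / 4 : ℝ) • (bc - abc) := by
    rw [map_sub, u1, u2]; module
  have f0 := form_eq_zero_of_mul_eq_smul R.assoc (by norm_num) ha.idem q
  rw [e, map_smul, map_smul, f0, smul_zero, zero_smul, q] at h
  refine hneq (sub_eq_zero.1 ?_)
  rw [smul_smul] at h
  exact (smul_eq_zero.1 h).resolve_left (by norm_num)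

end MajoranaRepresentation

/-! ### Permutation representations and the abstract extension of `S₃ × S₃ × 2` -/

section PermHom

/-- A group generated by elements permuting a family of points permutes the family. -/
theorem exists_permHom {H Ω ι : Type*} [Group H] {S : Set H} (hS : Subgroup.closure S = ⊤)
    (act : H →* Equiv.Perm Ω) {v : ι → Ω} (hv : Function.Injective v)
    (h : ∀ g ∈ S, ∃ π : Equiv.Perm ι, ∀ i, act g (v i) = v (π i)) :
    ∃ f : H →* Equiv.Perm ι, ∀ g i, act g (v i) = v (f g i) := by
  have key : ∀ g : H, ∃ π : Equiv.Perm ι, ∀ i, act g (v i) = v (π i) := by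
    intro g
    have hg : g ∈ Subgroup.closure S := hS ▸ Subgroup.mem_top g
    induction hg using Subgroup.closure_induction with
    | mem g hg => exact h g hg
    | one => exact ⟨1, by simp⟩
    | mul g g' _ _ hg hg' =>
      obtain ⟨π, hπ⟩ := hg
      obtain ⟨π', hπ'⟩ := hg'
      exact ⟨π * π', fun i => by simp [hπ, hπ']⟩
    | inv g _ hg =>
      obtain ⟨π, hπ⟩ := hg
      refine ⟨π⁻¹, fun i => ?_⟩
      rw [map_inv, Equiv.Perm.inv_eq_iff_eq, hπ]
      simp
  choose f hf using key
  refine ⟨MonoidHom.mk' f fun g g' => ?_, hf⟩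
  ext i
  apply hv
  rw [← hf, map_mul, Equiv.Perm.mul_apply, hf, hf, Equiv.Perm.mul_apply]

theorem permHom_apply_eq {H Ω ι : Type*} [Group H] {act : H →* Equiv.Perm Ω} {v : ι → Ω}
    (hv : Function.Injective v) {f : H →* Equiv.Perm ι} (hf : ∀ g i, act g (v i) = v (f g i))
    {g : H} {π : Equiv.Perm ι} (h : ∀ i, act g (v i) = v (π i)) : f g = π := by
  ext i
  exact hv ((hf g i).symm.trans (h i))

end PermHom

open Equiv in
/-- The action of a group by conjugation through a permutation representation. -/
def conjAct {H α : Type*} [Group H] (f : H →* Perm α) : H →* Perm (Perm α) where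
  toFun g := (MulAut.conj (f g)).toEquiv
  map_one' := by ext; simp
  map_mul' g h := by ext; simp

theorem conjAct_apply {H α : Type*} [Group H] (f : H →* Equiv.Perm α) (g : H)
    (x : Equiv.Perm α) : conjAct f g x = f g * x * (f g)⁻¹ := rfl

/-- A group extending `S₃ × S₃ × 2` in which the elements of order `3` of the factors `S₃` act
fixed point freely on the kernel modulo its central subgroup `{1, z}`. -/
structure DoubleS3Extension (G : Type*) [Group G] where
  p : G →* Equiv.Perm (Fin 3)
  q : G →* Equiv.Perm (Fin 3)
  ε : G →* ℤˣ
  z : G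
  z_comm : ∀ g, z * g = g * z
  z_sq : z * z = 1
  p_z : p z = 1
  q_z : q z = 1
  ε_z : ε z = -1
  p_large : ∃ g, p g ^ 2 ≠ 1
  q_large : ∃ g, q g ^ 2 ≠ 1
  sign_ne : ∃ g, Equiv.Perm.sign (p g) ≠ Equiv.Perm.sign (q g)
  centralizer : ∀ n x, p n = 1 → q n = 1 → n * x = x * n →
    (p x = 1 ∧ q x ^ 2 ≠ 1 ∨ p x ^ 2 ≠ 1 ∧ q x = 1) → n = 1 ∨ n = z

namespace DoubleS3Extension

variable {G H : Type*} [Group G] [Group H]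

/-- Interchange of the two homomorphisms to `S₃`. -/
def swap (D : DoubleS3Extension G) : DoubleS3Extension G where
  p := D.q
  q := D.p
  ε := D.ε
  z := D.z
  z_comm := D.z_comm
  z_sq := D.z_sq
  p_z := D.q_z
  q_z := D.p_z
  ε_z := D.ε_z
  p_large := D.q_large
  q_large := D.p_large
  sign_ne := D.sign_ne.imp fun _ h => h.symm
  centralizer n x hp hq hx h := D.centralizer n x hq hp hx (by tauto)

/-- Transport along an isomorphism. -/
def comap (D : DoubleS3Extension G) (e : H ≃* G) : DoubleS3Extension H where
  p := D.p.comp e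
  q := D.q.comp e
  ε := D.ε.comp e
  z := e.symm D.z
  z_comm g := e.injective (by simpa using D.z_comm (e g))
  z_sq := e.injective (by simpa using D.z_sq)
  p_z := by simpa using D.p_z
  q_z := by simpa using D.q_z
  ε_z := by simpa using D.ε_z
  p_large := by
    obtain ⟨g, hg⟩ := D.p_large
    exact ⟨e.symm g, by simpa using hg⟩
  q_large := by
    obtain ⟨g, hg⟩ := D.q_large
    exact ⟨e.symm g, by simpa using hg⟩
  sign_ne := by
    obtain ⟨g, hg⟩ := D.sign_ne
    exact ⟨e.symm g, by simpa using hg⟩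
  centralizer n x hp hq hx h := by
    rcases D.centralizer (e n) (e x) hp hq (by rw [← map_mul, hx, map_mul]) h with h | h
    · exact Or.inl (e.injective (by rw [h, map_one]))
    · exact Or.inr (e.injective (by rw [h, MulEquiv.apply_symm_apply]))

end DoubleS3Extension

/-! ### Structure of `G₉` -/

namespace G9

open Equiv

/-- The first generator of `G₉`. -/
def genA : Perm (Fin 12) := swap 0 1 * swap 2 3 * swap 4 5 * swap 6 7

/-- The second generator of `G₉`. -/
def genB : Perm (Fin 12) := swap 0 7 * swap 1 6 * swap 2 3 * swap 4 5

/-- The third generator of `G₉`. -/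
def genC : Perm (Fin 12) := swap 1 4 * swap 2 5 * swap 8 9 * swap 10 11

/-- The central involution of `G₉`. -/
def genZ : Perm (Fin 12) := swap 8 9 * swap 10 11

/-- The involutions of the Klein four-groups on the blocks `{0, 2, 5, 6}` and `{1, 3, 4, 7}`. -/
def klein : Fin 6 → Perm (Fin 12) :=
  ![swap 0 2 * swap 5 6, swap 0 5 * swap 2 6, swap 0 6 * swap 2 5,
    swap 1 3 * swap 4 7, swap 1 4 * swap 3 7, swap 1 7 * swap 3 4]

/-- The action of `genA` on `klein`. -/
def kleinA : Perm (Fin 6) := swap 0 3 * swap 1 4 * swap 2 5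

/-- The action of `genB` on `klein`. -/
def kleinB : Perm (Fin 6) := swap 0 4 * swap 1 3 * swap 2 5

/-- The action of `genC` on `klein`. -/
def kleinC : Perm (Fin 6) := swap 0 1 * swap 3 5

/-- The involutions of the first factor `S₃` of the action on `klein`. -/
def factorP : Fin 3 → Perm (Fin 6) :=
  ![swap 0 3 * swap 1 5 * swap 2 4, swap 0 4 * swap 1 3 * swap 2 5,
    swap 0 5 * swap 1 4 * swap 2 3]

/-- The involutions of the second factor `S₃` of the action on `klein`. -/
def factorQ : Fin 3 → Perm (Fin 6) :=
  ![swap 0 3 * swap 1 4 * swap 2 5, swap 0 4 * swap 1 5 * swap 2 3,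
    swap 0 5 * swap 1 3 * swap 2 4]

theorem klein_injective : Function.Injective klein := by
  intro i j; revert i j; decide +kernel

theorem factorP_injective : Function.Injective factorP := by
  intro i j; revert i j; decide +kernel

theorem factorQ_injective : Function.Injective factorQ := by
  intro i j; revert i j; decide +kernel

theorem genA_mem : genA ∈ G9 := Subgroup.subset_closure (Or.inl rfl)

theorem genB_mem : genB ∈ G9 := Subgroup.subset_closure (Or.inr (Or.inl rfl))

theorem genC_mem : genC ∈ G9 := Subgroup.subset_closure (Or.inr (Or.inr rfl))

theorem genZ_eq : genZ = (genA * genB * ((genA * genC)⁻¹ * genC * (genA * genC))) ^ 3 := by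
  decide +kernel

theorem genZ_mem : genZ ∈ G9 := by
  have hac := mul_mem genA_mem genC_mem
  rw [genZ_eq]
  exact pow_mem (mul_mem (mul_mem genA_mem genB_mem)
    (mul_mem (mul_mem (inv_mem hac) genC_mem) hac)) 3

theorem closure_eq_top : Subgroup.closure ({⟨genA, genA_mem⟩, ⟨genB, genB_mem⟩,
    ⟨genC, genC_mem⟩} : Set G9) = ⊤ := by
  have h : Subgroup.closure (((↑) : G9 → Perm (Fin 12)) ⁻¹' {genA, genB, genC}) = ⊤ :=
    Subgroup.closure_closure_coe_preimage
  rw [← h]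
  congr 1
  ext ⟨x, hx⟩
  simp [Subtype.ext_iff]

theorem genZ_comm (g : G9) : genZ * g = g * genZ := by
  have h : G9 ≤ Subgroup.centralizer {genZ} := by
    rw [G9, Subgroup.closure_le]
    rintro x (rfl | rfl | rfl) <;> rw [SetLike.mem_coe, Subgroup.mem_centralizer_singleton_iff] <;>
    decide +kernel
  exact (Subgroup.mem_centralizer_singleton_iff.1 (h g.2)).symm

theorem eq_or_eq_genZ_mul {g : Perm (Fin 12)} (hg : g ∈ G9) :
    (∀ i, 8 ≤ i → g i = i) ∨ (∀ i, 8 ≤ i → g i = genZ i) := by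
  have hZ : ∀ i, 8 ≤ i → 8 ≤ genZ i ∧ genZ (genZ i) = i := by decide +kernel
  rw [G9] at hg
  induction hg using Subgroup.closure_induction with
  | mem g hg => rcases hg with rfl | rfl | rfl <;> decide +kernel
  | one => exact Or.inl fun i _ => rfl
  | mul g h _ _ hg hh =>
    rcases hg with hg | hg <;> rcases hh with hh | hh
    · exact Or.inl fun i hi => by rw [Perm.mul_apply, hh i hi, hg i hi]
    · exact Or.inr fun i hi => by rw [Perm.mul_apply, hh i hi, hg _ (hZ i hi).1]
    · exact Or.inr fun i hi => by rw [Perm.mul_apply, hh i hi, hg i hi]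
    · exact Or.inl fun i hi => by rw [Perm.mul_apply, hh i hi, hg _ (hZ i hi).1, (hZ i hi).2]
  | inv g _ hg =>
    rcases hg with hg | hg
    · exact Or.inl fun i hi => by rw [Perm.inv_eq_iff_eq, hg i hi]
    · exact Or.inr fun i hi => by rw [Perm.inv_eq_iff_eq, hg _ (hZ i hi).1, (hZ i hi).2]

-- The two factors act on the six points as the left and right regular representations of `S₃`. A
-- permutation centralizing both lies in the centre of `S₃`, which is trivial.
set_option maxRecDepth 10000 in
theorem eq_one_of_fix_factors : ∀ π : Perm (Fin 6), (∀ i, π * factorP i * π⁻¹ = factorP i) →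
    (∀ i, π * factorQ i * π⁻¹ = factorQ i) → π = 1 := by
  decide +kernel

/-- The elements of order `3` of the two factors rotate both blocks of `klein`. -/
theorem rotates_of_fix_factorP : ∀ π : Perm (Fin 6), (∀ i, π * factorP i * π⁻¹ = factorP i) →
    ∀ ρ : Perm (Fin 3), ρ ^ 2 ≠ 1 → (∀ i, π * factorQ i * π⁻¹ = factorQ (ρ i)) →
    ∀ i, π i ≠ i ∧ (π i < 3 ↔ i < 3) := by
  decide +kernel

theorem rotates_of_fix_factorQ : ∀ π : Perm (Fin 6), (∀ i, π * factorQ i * π⁻¹ = factorQ i) →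
    ∀ ρ : Perm (Fin 3), ρ ^ 2 ≠ 1 → (∀ i, π * factorP i * π⁻¹ = factorP (ρ i)) →
    ∀ i, π i ≠ i ∧ (π i < 3 ↔ i < 3) := by
  decide +kernel

/-- Two points on which the same members of `klein` act trivially lie in one block. -/
theorem eq_or_klein_of_fix : ∀ x y : Fin 12, x < 8 → (∀ i, klein i x = x ↔ klein i y = y) →
    y = x ∨ ∃ i, y = klein i x ∧ x = klein i y := by
  decide +kernel

theorem klein_block : ∀ (i j : Fin 6) (x : Fin 12), x < 8 → (j < 3 ↔ i < 3) →
    (klein i x = x ↔ klein j x = x) ∧ (klein i x ≠ x → klein i x = klein j x → i = j) := by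
  decide +kernel

theorem klein_comm : ∀ i j : Fin 6, klein i * klein j = klein j * klein i := by
  decide +kernel

/-- A permutation `n` centralizing the Klein groups moves `u` as some `klein i` does. Commuting with
a permutation that rotates the three involutions of each block leaves only the identity. -/
theorem apply_eq_self_of_commute {n x : Perm (Fin 12)} (hn : ∀ i, n * klein i * n⁻¹ = klein i)
    {π : Perm (Fin 6)} (hx : ∀ i, x * klein i * x⁻¹ = klein (π i)) (hnx : n * x = x * n)
    (hπ : ∀ i, π i ≠ i ∧ (π i < 3 ↔ i < 3)) {u : Fin 12} (hu : u < 8) : n u = u := by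
  have hn' : ∀ i w, klein i (n w) = n (klein i w) := fun i w => by
    rw [← Perm.mul_apply, ← Perm.mul_apply, ← mul_inv_eq_iff_eq_mul.1 (hn i)]
  have hx' : ∀ i w, klein (π i) (x w) = x (klein i w) := fun i w => by
    rw [← Perm.mul_apply, ← Perm.mul_apply, ← mul_inv_eq_iff_eq_mul.1 (hx i)]
  have hnx' : ∀ w, n (x w) = x (n w) := fun w => by
    rw [← Perm.mul_apply, hnx, Perm.mul_apply]
  rcases eq_or_klein_of_fix u (n u) hu (fun i => by rw [hn', n.injective.eq_iff]) with h | ⟨i, h, -⟩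
  · exact h
  -- Correct `x` by a Klein involution to fix `u`. It still commutes with `n` and induces `π`, so
  -- `klein i u = n u = y (n u) = klein (π i) u`, although `π i ≠ i`.
  obtain ⟨y, hyu, hyn, hyk⟩ : ∃ y : Perm (Fin 12), y u = u ∧ (∀ w, n (y w) = y (n w)) ∧
      ∀ i w, klein (π i) (y w) = y (klein i w) := by
    have hb : ∀ j, klein j u = u ↔ klein j (x u) = x u := by
      intro j
      obtain ⟨j, rfl⟩ := π.surjective j
      rw [hx', x.injective.eq_iff]
      exact (klein_block _ _ u hu (hπ j).2.symm).1
    rcases eq_or_klein_of_fix u (x u) hu hb with h' | ⟨j, -, h'⟩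
    · exact ⟨x, h', hnx', hx'⟩
    · refine ⟨klein j * x, h'.symm, fun w => ?_, fun i w => ?_⟩
      · simp only [Perm.mul_apply]
        rw [← hn', hnx']
      · simp only [Perm.mul_apply]
        rw [← hx', ← Perm.mul_apply, klein_comm, Perm.mul_apply]
  by_contra hne
  rw [h] at hne
  have e : klein i u = klein (π i) u := by
    have h1 := hyn u
    rw [hyu, h, ← hyk, hyu] at h1
    exact h1
  exact (hπ i).1 ((klein_block i (π i) u hu (hπ i).2).2 hne e).symm

theorem eq_one_or_eq_genZ {n : Perm (Fin 12)} (hn : n ∈ G9) (h : ∀ u, u < 8 → n u = u) :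
    n = 1 ∨ n = genZ := by
  have hZ : ∀ u, u < 8 → genZ u = u := by decide +kernel
  rcases eq_or_eq_genZ_mul hn with h8 | h8
  · left
    ext1 u
    rcases lt_or_ge u 8 with hu | hu
    · exact h u hu
    · exact h8 u hu
  · right
    ext1 u
    rcases lt_or_ge u 8 with hu | hu
    · rw [h u hu, hZ u hu]
    · exact h8 u hu

theorem exists_kleinHom : ∃ f : G9 →* Perm (Fin 6),
    (∀ (g : G9) i, g * klein i * (g : Perm (Fin 12))⁻¹ = klein (f g i)) ∧
    f ⟨genA, genA_mem⟩ = kleinA ∧ f ⟨genB, genB_mem⟩ = kleinB ∧ f ⟨genC, genC_mem⟩ = kleinC ∧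
    f ⟨genZ, genZ_mem⟩ = 1 := by
  have hA : ∀ i, genA * klein i * genA⁻¹ = klein (kleinA i) := by decide +kernel
  have hB : ∀ i, genB * klein i * genB⁻¹ = klein (kleinB i) := by decide +kernel
  have hC : ∀ i, genC * klein i * genC⁻¹ = klein (kleinC i) := by decide +kernel
  have hZ : ∀ i, genZ * klein i * genZ⁻¹ = klein i := by decide +kernel
  obtain ⟨f, hf⟩ := exists_permHom closure_eq_top (conjAct G9.subtype) klein_injective (by
    rintro g (rfl | rfl | rfl)
    exacts [⟨kleinA, hA⟩, ⟨kleinB, hB⟩, ⟨kleinC, hC⟩])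
  exact ⟨f, hf, permHom_apply_eq klein_injective hf hA, permHom_apply_eq klein_injective hf hB,
    permHom_apply_eq klein_injective hf hC, permHom_apply_eq klein_injective hf hZ⟩

theorem exists_signHom : ∃ f : G9 →* ℤˣ, f ⟨genZ, genZ_mem⟩ = -1 := by
  let v : Fin 2 → Fin 12 := ![8, 9]
  have hv : Function.Injective v := by decide
  obtain ⟨f, hf⟩ := exists_permHom closure_eq_top (MonoidHom.id _ |>.comp G9.subtype) hv (by
    rintro g (rfl | rfl | rfl)
    exacts [⟨1, by decide +kernel⟩, ⟨1, by decide +kernel⟩, ⟨swap 0 1, by decide +kernel⟩])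
  refine ⟨Perm.sign.comp f, ?_⟩
  have : f ⟨genZ, genZ_mem⟩ = swap 0 1 := permHom_apply_eq hv hf (by decide +kernel)
  rw [MonoidHom.comp_apply, this]
  decide

theorem nonempty_doubleS3Extension : Nonempty (DoubleS3Extension G9) := by
  obtain ⟨k, hk, hA, hB, hC, hZ⟩ := exists_kleinHom
  obtain ⟨ε, hε⟩ := exists_signHom
  have pA : ∀ i, kleinA * factorP i * kleinA⁻¹ = factorP i := by decide +kernel
  have pB : ∀ i, kleinB * factorP i * kleinB⁻¹ = factorP (swap 0 2 i) := by decide +kernel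
  have pC : ∀ i, kleinC * factorP i * kleinC⁻¹ = factorP (swap 1 2 i) := by decide +kernel
  have qA : ∀ i, kleinA * factorQ i * kleinA⁻¹ = factorQ (swap 1 2 i) := by decide +kernel
  have qB : ∀ i, kleinB * factorQ i * kleinB⁻¹ = factorQ i := by decide +kernel
  have qC : ∀ i, kleinC * factorQ i * kleinC⁻¹ = factorQ (swap 0 1 i) := by decide +kernel
  rw [← hA] at pA qA
  rw [← hB] at pB qB
  rw [← hC] at pC qC
  obtain ⟨p, hp⟩ := exists_permHom closure_eq_top (conjAct k) factorP_injective (by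
    rintro g (rfl | rfl | rfl)
    exacts [⟨1, pA⟩, ⟨swap 0 2, pB⟩, ⟨swap 1 2, pC⟩])
  obtain ⟨q, hq⟩ := exists_permHom closure_eq_top (conjAct k) factorQ_injective (by
    rintro g (rfl | rfl | rfl)
    exacts [⟨swap 1 2, qA⟩, ⟨1, qB⟩, ⟨swap 0 1, qC⟩])
  have pA' : p _ = 1 := permHom_apply_eq factorP_injective hp pA
  have pB' := permHom_apply_eq factorP_injective hp pB
  have pC' := permHom_apply_eq factorP_injective hp pC
  have qA' := permHom_apply_eq factorQ_injective hq qA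
  have qB' : q _ = 1 := permHom_apply_eq factorQ_injective hq qB
  have qC' := permHom_apply_eq factorQ_injective hq qC
  refine ⟨{ p := p, q := q, ε := ε, z := ⟨genZ, genZ_mem⟩,
            z_comm := fun g => Subtype.ext (genZ_comm g),
            z_sq := Subtype.ext (by decide +kernel : genZ * genZ = 1),
            p_z := ?_, q_z := ?_, ε_z := hε, p_large := ?_, q_large := ?_, sign_ne := ?_,
            centralizer := ?_ }⟩
  · refine permHom_apply_eq factorP_injective hp fun i => ?_
    rw [conjAct_apply, hZ]; simp
  · refine permHom_apply_eq factorQ_injective hq fun i => ?_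
    rw [conjAct_apply, hZ]; simp
  · refine ⟨⟨genB, genB_mem⟩ * ⟨genC, genC_mem⟩, ?_⟩
    rw [map_mul, pB', pC']; decide
  · refine ⟨⟨genA, genA_mem⟩ * ⟨genC, genC_mem⟩, ?_⟩
    rw [map_mul, qA', qC']; decide
  · refine ⟨⟨genA, genA_mem⟩, ?_⟩
    rw [pA', qA']; decide
  · rintro n x hpn hqn hnx hx
    have hk1 : k n = 1 := by
      refine eq_one_of_fix_factors _ (fun i => ?_) (fun i => ?_)
      · have := hp n i; rwa [hpn] at this
      · have := hq n i; rwa [hqn] at this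
    have hrot : ∀ i, k x i ≠ i ∧ (k x i < 3 ↔ i < 3) := by
      rcases hx with ⟨h1, h2⟩ | ⟨h1, h2⟩
      · exact rotates_of_fix_factorP _ (fun i => by have := hp x i; rwa [h1] at this) _ h2 (hq x)
      · exact rotates_of_fix_factorQ _ (fun i => by have := hq x i; rwa [h2] at this) _ h1 (hp x)
    have := eq_one_or_eq_genZ n.2 fun u hu => apply_eq_self_of_commute
      (fun i => by have := hk n i; rwa [hk1] at this) (hk x) (congrArg Subtype.val hnx) hrot hu
    exact this.imp (fun h => Subtype.ext h) (fun h => Subtype.ext h)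

end G9

/-! ### Involutions in `S₃` and generating triples -/

theorem orderOf_eq_six {G : Type*} [Group G] {x : G} (h6 : x ^ 6 = 1) (h3 : x ^ 3 ≠ 1)
    (h2 : x ^ 2 ≠ 1) : orderOf x = 6 := by
  refine orderOf_eq_of_pow_and_pow_div_prime (by norm_num) h6 fun p hp hd => ?_
  have hp6 : p ∈ Nat.primeFactors 6 := Nat.mem_primeFactors.2 ⟨hp, hd, by norm_num⟩
  rw [show Nat.primeFactors 6 = {2, 3} by decide +kernel] at hp6
  rcases Finset.mem_insert.1 hp6 with rfl | h
  · exact h3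
  · rw [Finset.mem_singleton.1 h]; exact h2

theorem units_pow_three (e : ℤˣ) : e ^ 3 = e := by
  rcases Int.units_eq_one_or e with rfl | rfl <;> decide

theorem conjBy_apply_hom {G M : Type*} [Group G] [Group M] (f : G →* M) (x g : G) :
    f (conjBy x g) = conjBy (f x) (f g) := by
  simp [conjBy]

theorem conjBy_eq_self {M : Type*} [CommGroup M] (x g : M) : conjBy x g = x := by
  rw [conjBy, mul_comm g⁻¹ x, inv_mul_cancel_right]

theorem conjBy_mul_self {G : Type*} [Group G] {x g : G} (hx : x * x = 1) :
    conjBy x g * conjBy x g = 1 := by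
  simp only [conjBy]
  rw [show g⁻¹ * x * g * (g⁻¹ * x * g) = g⁻¹ * (x * x) * g by group, hx]
  group

theorem perm_three_conj : ∀ x w : Equiv.Perm (Fin 3), x * x = 1 → w * w = 1 → x ≠ 1 → w ≠ 1 →
    w ≠ x → conjBy w (x * w) = x ∧ (x * w) ^ 3 = 1 ∧ (x * w) ^ 2 ≠ 1 := by
  decide +kernel

theorem perm_three_pow_four : ∀ x w : Equiv.Perm (Fin 3), x * x = 1 → w * w = 1 → x ≠ 1 → w ≠ 1 →
    w ≠ x → (x * conjBy x w) ^ 4 ≠ 1 := by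
  decide +kernel

theorem perm_three_pow_three : ∀ x : Equiv.Perm (Fin 3), x ^ 2 ≠ 1 →
    x ^ 3 = 1 ∧ (x ^ 2) ^ 2 ≠ 1 := by
  decide +kernel

set_option synthInstance.maxHeartbeats 400000 in
set_option synthInstance.maxSize 1000 in
/-- Involutions generating a non-abelian subgroup of `S₃`, the first two of which commute. -/
theorem perm_three_cases : ∀ x y w : Equiv.Perm (Fin 3), x * x = 1 → y * y = 1 → w * w = 1 →
    x * y = y * x →
    (∃ s, s * s = 1 ∧ (x = 1 ∨ x = s) ∧ (y = 1 ∨ y = s) ∧ (w = 1 ∨ w = s)) ∨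
    w ≠ 1 ∧ w ≠ x ∧ w ≠ y ∧ w ≠ x * y ∧
      (x = 1 ∧ y ≠ 1 ∨ x ≠ 1 ∧ y = 1 ∨ x = y ∧ x ≠ 1) := by
  decide +kernel

theorem perm_three_sign : ∀ x : Equiv.Perm (Fin 3), x * x = 1 → x ≠ 1 →
    Equiv.Perm.sign x = -1 := by
  decide +kernel

/-- The elements `x, y, c` generate `G`. -/
def Generates {G : Type*} [Group G] (x y c : G) : Prop :=
  ∀ H : Subgroup G, x ∈ H → y ∈ H → c ∈ H → H = ⊤

namespace Generates

variable {G M : Type*} [Group G] [Group M] {x y c : G}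

theorem of_closure (h : Subgroup.closure {x, y, c} = (⊤ : Subgroup G)) : Generates x y c := by
  intro H hx hy hc
  rw [eq_top_iff, ← h, Subgroup.closure_le]
  rintro g (rfl | rfl | rfl) <;> assumption

theorem swap (h : Generates x y c) : Generates y x c := fun H hx hy hc => h H hy hx hc

theorem mul_right (h : Generates x y c) : Generates x (x * y) c := fun H hx hy hc =>
  h H hx ((mul_mem_cancel_left hx).1 hy) hc

theorem hom_eq (h : Generates x y c) {f g : G →* M} (hx : f x = g x) (hy : f y = g y)
    (hc : f c = g c) (t : G) : f t = g t := by
  have := h (f.eqLocus g) hx hy hc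
  exact (this ▸ Subgroup.mem_top t : t ∈ f.eqLocus g)

theorem mem (h : Generates x y c) {f : G →* M} {S : Subgroup M} (hx : f x ∈ S) (hy : f y ∈ S)
    (hc : f c ∈ S) (t : G) : f t ∈ S := by
  have := h (S.comap f) hx hy hc
  exact (this ▸ Subgroup.mem_top t : t ∈ S.comap f)

/-- If the images all lay in a group `{1, s}`, every element of the image of `f` would square to 1.
So the image is non-abelian, and `f` kills exactly one of `x, y, xy`. -/
theorem perm_three (h : Generates x y c) {f : G →* Equiv.Perm (Fin 3)} (hf : ∃ g, f g ^ 2 ≠ 1)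
    (hx : x * x = 1) (hy : y * y = 1) (hc : c * c = 1) (hxy : x * y = y * x) :
    f c ≠ 1 ∧ f c ≠ f x ∧ f c ≠ f y ∧ f c ≠ f x * f y ∧
      (f x = 1 ∧ f y ≠ 1 ∨ f x ≠ 1 ∧ f y = 1 ∨ f x = f y ∧ f x ≠ 1) := by
  have sq : ∀ {g : G}, g * g = 1 → f g * f g = 1 := fun hg => by rw [← map_mul, hg, map_one]
  refine (perm_three_cases (f x) (f y) (f c) (sq hx) (sq hy) (sq hc)
    (by rw [← map_mul, hxy, map_mul])).resolve_left ?_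
  rintro ⟨s, hs, hx', hy', hc'⟩
  obtain ⟨g, hg⟩ := hf
  have hmem : ∀ u, u = 1 ∨ u = s → u ∈ Subgroup.zpowers s := by
    rintro u (rfl | rfl)
    exacts [one_mem _, Subgroup.mem_zpowers _]
  obtain ⟨k, hk⟩ := Subgroup.mem_zpowers_iff.1
    (h.mem (hmem _ hx') (hmem _ hy') (hmem _ hc') g)
  apply hg
  rw [← hk, ← zpow_natCast, ← zpow_mul, mul_comm, zpow_mul, zpow_natCast, pow_two, hs, one_zpow]

end Generates

/-! ### Involutions of `⟨a, b, z⟩` obtained from a generating triple -/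

namespace DoubleS3Extension

variable {G : Type*} [Group G]

/-- The position of a generating triple relative to the two homomorphisms to `S₃`. -/
structure Good (D : DoubleS3Extension G) (a b c : G) : Prop where
  aa : a * a = 1
  bb : b * b = 1
  cc : c * c = 1
  ab : a * b = b * a
  pb : D.p b = 1
  qa : D.q a = 1
  pa : D.p a ≠ 1
  qb : D.q b ≠ 1
  pc : D.p c ≠ 1
  qc : D.q c ≠ 1
  pac : D.p c ≠ D.p a
  qbc : D.q c ≠ D.q b
  ε_abc : D.ε a * D.ε b * D.ε c = -1

variable {D : DoubleS3Extension G} {a b c : G}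

theorem Good.swap (h : D.Good a b c) : D.swap.Good b a c :=
  ⟨h.bb, h.aa, h.cc, h.ab.symm, h.qa, h.pb, h.qb, h.pa, h.qc, h.pc, h.qbc, h.pac,
    by rw [mul_comm (D.swap.ε b)]; exact h.ε_abc⟩

theorem map_mul_self (f : G →* Equiv.Perm (Fin 3)) {x : G} (hx : x * x = 1) : f x * f x = 1 := by
  rw [← map_mul, hx, map_one]

theorem eq_z_of_ne_one {D : DoubleS3Extension G} {n x : G} (hp : D.p n = 1) (hq : D.q n = 1)
    (hε : D.ε n = -1) (hx : n * x = x * n) (h : D.p x = 1 ∧ D.q x ^ 2 ≠ 1) : n = D.z := by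
  refine (D.centralizer n x hp hq hx (Or.inl h)).resolve_left ?_
  rintro rfl
  rw [map_one] at hε
  exact absurd hε (by decide)

theorem z_ne_one (D : DoubleS3Extension G) : D.z ≠ 1 := by
  intro h
  have := D.ε_z
  rw [h, map_one] at this
  exact absurd this (by decide)

theorem Good.p_conjBy (h : D.Good a b c) : D.p (conjBy c (a * c)) = D.p a := by
  rw [conjBy_apply_hom, map_mul]
  exact (perm_three_conj _ _ (map_mul_self _ h.aa) (map_mul_self _ h.cc) h.pa h.pc h.pac).1

theorem Good.q_conjBy (h : D.Good a b c) : D.q (conjBy c (a * c)) = D.q c := by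
  rw [conjBy_apply_hom, map_mul, h.qa, one_mul, conjBy, inv_mul_cancel, one_mul]

theorem Good.ε_conjBy (D : DoubleS3Extension G) (c g : G) : D.ε (conjBy c g) = D.ε c := by
  rw [conjBy_apply_hom, conjBy_eq_self]

theorem Good.q_mul (h : D.Good a b c) :
    (D.q b * D.q c) ^ 3 = 1 ∧ (D.q b * D.q c) ^ 2 ≠ 1 :=
  (perm_three_conj _ _ (map_mul_self _ h.bb) (map_mul_self _ h.cc) h.qb h.qc h.qbc).2

/-- The element `ab·c^{ac}` is trivial under `p` and of order 3 under `q`. Its cube lies in both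
kernels and commutes with it, so `centralizer` leaves 1 and `z`, and `ε` selects `z`. -/
theorem Good.pow_three_eq_z (h : D.Good a b c) :
    (a * b * conjBy c (a * c)) ^ 3 = D.z := by
  have hp : D.p (a * b * conjBy c (a * c)) = 1 := by
    rw [map_mul, map_mul, h.p_conjBy, h.pb, mul_one, map_mul_self _ h.aa]
  have hq : D.q (a * b * conjBy c (a * c)) = D.q b * D.q c := by
    rw [map_mul, map_mul, h.q_conjBy, h.qa, one_mul]
  refine eq_z_of_ne_one (by rw [map_pow, hp, one_pow]) (by rw [map_pow, hq, h.q_mul.1]) ?_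
    (pow_mul_comm' _ 3) ⟨hp, by rw [hq]; exact h.q_mul.2⟩
  rw [map_pow, units_pow_three, map_mul, map_mul, Good.ε_conjBy, h.ε_abc]

theorem Good.orderOf_eq_six (h : D.Good a b c) :
    orderOf (a * b * conjBy c (a * c)) = 6 := by
  have h3 := h.pow_three_eq_z
  refine _root_.orderOf_eq_six ?_ (by rw [h3]; exact D.z_ne_one) fun h2 => ?_
  · rw [show 6 = 3 * 2 from rfl, pow_mul, h3, pow_two, D.z_sq]
  · have := congrArg D.q h2
    rw [map_pow, map_mul, map_mul, h.q_conjBy, h.qa, one_mul, map_one] at this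
    exact h.q_mul.2 this

/-- Since `a·c^{ac} = (ac)³`, the claim amounts to `(ac)⁶ = 1`. This element commutes with `(ac)²`,
which has order 3 under `p` and is trivial under `q`; being a square, it has `ε = 1` and is not `z`.
-/
theorem Good.commute (h : D.Good a b c) : a * conjBy c (a * c) = conjBy c (a * c) * a := by
  have h6 : (a * c) ^ 6 = 1 := by
    have hpp := (perm_three_conj _ _ (map_mul_self D.p h.aa) (map_mul_self D.p h.cc)
      h.pa h.pc h.pac).2.2
    have hpp' := perm_three_pow_three _ hpp
    have hqq : D.q ((a * c) ^ 2) = 1 := by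
      rw [map_pow, map_mul, h.qa, one_mul, pow_two, map_mul_self _ h.cc]
    have hp2 : D.p ((a * c) ^ 2) = (D.p a * D.p c) ^ 2 := by rw [map_pow, map_mul]
    rw [show 6 = 2 * 3 from rfl, pow_mul]
    refine (D.centralizer _ ((a * c) ^ 2) ?_ ?_ (pow_mul_comm' _ 3)
      (Or.inr ⟨?_, hqq⟩)).resolve_right fun hz => ?_
    · rw [map_pow, hp2, ← pow_mul, mul_comm, pow_mul, hpp'.1, one_pow]
    · rw [map_pow, hqq, one_pow]
    · rw [hp2]; exact hpp'.2
    · have := congrArg D.ε hz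
      rw [D.ε_z, map_pow, units_pow_three, map_pow, pow_two, Int.units_mul_self] at this
      exact absurd this (by decide)
  have ai : a⁻¹ = a := inv_eq_of_mul_eq_one_left h.aa
  have ci : c⁻¹ = c := inv_eq_of_mul_eq_one_left h.cc
  have e1 : a * conjBy c (a * c) = (a * c) ^ 3 := by
    rw [conjBy, mul_inv_rev, ai, ci, pow_three]
    simp only [mul_assoc]
  have e2 : conjBy c (a * c) * a = ((a * c) ^ 3)⁻¹ := by
    rw [conjBy, ← inv_pow, mul_inv_rev, ai, ci, pow_three]
    simp only [mul_assoc]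
  rw [e1, e2, eq_inv_iff_mul_eq_one, ← pow_add, h6]

theorem Good.pow_three_eq_mul_z (h : D.Good a b c) :
    (b * conjBy c (a * c)) ^ 3 = a * D.z := by
  have hp : D.p (b * conjBy c (a * c)) = D.p a := by
    rw [map_mul, h.p_conjBy, h.pb, one_mul]
  have hq : D.q (b * conjBy c (a * c)) = D.q b * D.q c := by
    rw [map_mul, h.q_conjBy]
  have ha : Commute a (b * conjBy c (a * c)) :=
    (show Commute a b from h.ab).mul_right h.commute
  have key : a * (b * conjBy c (a * c)) ^ 3 = D.z := by
    refine eq_z_of_ne_one (x := (b * conjBy c (a * c)) ^ 2) ?_ ?_ ?_ ?_ ⟨?_, ?_⟩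
    · rw [map_mul, map_pow, hp, pow_three, map_mul_self _ h.aa, mul_one, map_mul_self _ h.aa]
    · rw [map_mul, map_pow, hq, h.q_mul.1, h.qa, one_mul]
    · rw [map_mul, map_pow, units_pow_three, map_mul, Good.ε_conjBy, ← mul_assoc, h.ε_abc]
    · exact ((ha.pow_right 2).mul_left (Commute.pow_pow_self _ 3 2))
    · rw [map_pow, hp, pow_two, map_mul_self _ h.aa]
    · rw [map_pow, hq]
      exact (perm_three_pow_three _ h.q_mul.2).2
  rw [← key, ← mul_assoc, h.aa, one_mul]

theorem Good.orderOf_eq_six' (h : D.Good a b c) :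
    orderOf (b * conjBy c (a * c)) = 6 := by
  have h3 := h.pow_three_eq_mul_z
  refine _root_.orderOf_eq_six ?_ (fun h1 => ?_) fun h2 => ?_
  · rw [show 6 = 3 * 2 from rfl, pow_mul, h3, pow_two, mul_assoc, ← mul_assoc D.z, D.z_comm,
      mul_assoc, D.z_sq, mul_one, h.aa]
  · rw [h3] at h1
    have := congrArg D.p h1
    rw [map_mul, D.p_z, mul_one, map_one] at this
    exact h.pa this
  · have := congrArg D.q h2
    rw [map_pow, map_mul, h.q_conjBy, map_one] at this
    exact h.q_mul.2 this

/-- A conjugation-stable set which contains the cubes of the products of order `6` of its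
elements contains all involutions of `⟨a, b, z⟩`. -/
theorem Good.mem (h : D.Good a b c) {T : Set G} (hb : b ∈ T) (ha : a ∈ T) (hc : c ∈ T)
    (hab : a * b ∈ T) (conj : ∀ t ∈ T, ∀ g : G, g * t * g⁻¹ ∈ T)
    (cube : ∀ t ∈ T, ∀ s ∈ T, orderOf (t * s) = 6 → (t * s) ^ 3 ∈ T) :
    D.z ∈ T ∧ a * D.z ∈ T ∧ b * D.z ∈ T ∧ a * b * D.z ∈ T := by
  have hw : ∀ g, conjBy c g ∈ T := fun g => by
    have := conj c hc g⁻¹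
    rwa [inv_inv] at this
  refine ⟨?_, ?_, ?_, ?_⟩
  · rw [← h.pow_three_eq_z]
    exact cube _ hab _ (hw _) h.orderOf_eq_six
  · rw [← h.pow_three_eq_mul_z]
    exact cube _ hb _ (hw _) h.orderOf_eq_six'
  · rw [← show D.swap.z = D.z from rfl, ← h.swap.pow_three_eq_mul_z]
    exact cube _ ha _ (hw _) h.swap.orderOf_eq_six'
  · have hz := h.pow_three_eq_z
    have hww : conjBy c (a * c) * conjBy c (a * c) = 1 := conjBy_mul_self h.cc
    have huu : a * b * (a * b) = 1 := by
      rw [mul_assoc, ← mul_assoc b, ← h.ab, mul_assoc, h.bb, mul_one, h.aa]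
    have hwT := hw (a * c)
    generalize conjBy c (a * c) = w at *
    generalize a * b = u at *
    -- From `(uw)³ = z` one gets `uz = wuwuw`, a conjugate of `c`; no cube is needed here.
    have e : u * D.z = w * u * w * (w * u)⁻¹ := by
      have ui : u⁻¹ = u := inv_eq_of_mul_eq_one_left huu
      have wi : w⁻¹ = w := inv_eq_of_mul_eq_one_left hww
      rw [← hz, mul_inv_rev, ui, wi, pow_three]
      simp only [← mul_assoc]
      rw [huu, one_mul]
    rw [e]
    exact conj _ hwT _

theorem Good.no_representation (h : D.Good a b c) {T : Set G} (ha : a ∈ T) (hb : b ∈ T)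
    (hc : c ∈ T) (hab : a * b ∈ T) {V : Type*} [AddCommGroup V] [Module ℝ V]
    (R : MajoranaRepresentation G T V) : False := by
  obtain ⟨h1, h2, h3, h4⟩ := h.mem hb ha hc hab R.stable
    (fun t ht s hs hts => R.pow_three_mem ht hs hts)
  refine R.false_of_pure ha hb h1 (h.ab ▸ hab) (D.z_comm a ▸ h2) h3 ?_ h.ab (D.z_comm a).symm
    (D.z_comm b).symm
  rwa [mul_assoc, D.z_comm, ← mul_assoc, ← h.ab]

/-- Only the value of `ε` on `abc` needs an argument. If it were 1, a product of `ε` with suitable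
powers of the signs of `p` and `q` would be trivial on `a`, `b` and hence on `c`, yet equal to `-1`
at `z`. -/
theorem good_of_generates (hgen : Generates a b c) (aa : a * a = 1) (bb : b * b = 1)
    (cc : c * c = 1) (ab : a * b = b * a) (pb : D.p b = 1) (qa : D.q a = 1) : D.Good a b c := by
  obtain ⟨pc, pca, -, -, hp⟩ := hgen.perm_three D.p_large aa bb cc ab
  obtain ⟨qc, -, qcb, -, hq⟩ := hgen.perm_three D.q_large aa bb cc ab
  have pa : D.p a ≠ 1 := by
    rcases hp with h | h | h
    exacts [absurd pb h.2, h.1, h.2]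
  have qb : D.q b ≠ 1 := by
    rcases hq with h | h | h
    exacts [h.2, absurd qa h.1, absurd qa h.2]
  refine ⟨aa, bb, cc, ab, pb, qa, pa, qb, pc, qc, pca, qcb, ?_⟩
  rcases Int.units_eq_one_or (D.ε a * D.ε b * D.ε c) with h1 | h1
  swap
  · exact h1
  exfalso
  have sgn : ∀ {f : G →* Equiv.Perm (Fin 3)} {x : G}, x * x = 1 → f x ≠ 1 →
      Equiv.Perm.sign (f x) = -1 := fun hx hf => perm_three_sign _ (map_mul_self _ hx) hf
  have sa := sgn aa pa
  have sb := sgn bb qb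
  have spc := sgn cc pc
  have sqc := sgn cc qc
  have hχ : ∀ i j : ℕ, D.ε a * (-1) ^ i = 1 → D.ε b * (-1) ^ j = 1 → False := by
    intro i j hi hj
    have := hgen.hom_eq (f := D.ε * (Equiv.Perm.sign.comp D.p) ^ i * (Equiv.Perm.sign.comp D.q) ^ j)
      (g := 1) (by simp [sa, qa, hi]) (by simp [sb, pb, hj]) (by
        have e : D.ε c * (-1) ^ i * (-1) ^ j = 1 := by
          calc D.ε c * (-1) ^ i * (-1) ^ j = (D.ε a * (-1) ^ i) * (D.ε b * (-1) ^ j) *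
                (D.ε a * D.ε b * D.ε c) := by
                rw [show (D.ε a * (-1) ^ i) * (D.ε b * (-1) ^ j) * (D.ε a * D.ε b * D.ε c) =
                  (D.ε a * D.ε a) * (D.ε b * D.ε b) * (D.ε c * (-1) ^ i * (-1) ^ j) by
                    simp only [mul_comm, mul_left_comm],
                  Int.units_mul_self, Int.units_mul_self, one_mul, one_mul]
            _ = 1 := by rw [hi, hj, h1, one_mul, one_mul]
        simpa [spc, sqc] using e) D.z
    simp [D.ε_z, D.p_z, D.q_z] at this
  rcases Int.units_eq_one_or (D.ε a) with h2 | h2 <;> rcases Int.units_eq_one_or (D.ε b) with h3 | h3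
  · exact hχ 0 0 (by simp [h2]) (by simp [h3])
  · exact hχ 0 1 (by simp [h2]) (by simp [h3])
  · exact hχ 1 0 (by simp [h2]) (by simp [h3])
  · exact hχ 1 1 (by simp [h2]) (by simp [h3])

/-- If `p` and `q` both killed `a`, their signs would agree on `a, b, c`, hence on `G`, against
`sign_ne`. -/
theorem not_fix_same (D : DoubleS3Extension G) (hgen : Generates a b c) (aa : a * a = 1)
    (bb : b * b = 1) (cc : c * c = 1) (ab : a * b = b * a) (pa : D.p a = 1) (qa : D.q a = 1) :
    False := by
  obtain ⟨pc, -, -, -, hp⟩ := hgen.perm_three D.p_large aa bb cc ab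
  obtain ⟨qc, -, -, -, hq⟩ := hgen.perm_three D.q_large aa bb cc ab
  have pb : D.p b ≠ 1 := by
    rcases hp with h | h | h
    exacts [h.2, absurd pa h.1, absurd pa h.2]
  have qb : D.q b ≠ 1 := by
    rcases hq with h | h | h
    exacts [h.2, absurd qa h.1, absurd qa h.2]
  obtain ⟨g, hg⟩ := D.sign_ne
  have sgn : ∀ {f : G →* Equiv.Perm (Fin 3)} {x : G}, x * x = 1 → f x ≠ 1 →
      Equiv.Perm.sign (f x) = -1 := fun hx hf => perm_three_sign _ (map_mul_self _ hx) hf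
  exact hg (hgen.hom_eq (f := Equiv.Perm.sign.comp D.p) (g := Equiv.Perm.sign.comp D.q)
    (by simp [pa, qa]) (by simp [sgn bb pb, sgn bb qb]) (by simp [sgn cc pc, sgn cc qc]) g)

theorem no_representation (D : DoubleS3Extension G) (hgen : Generates a b c) (aa : a * a = 1)
    (bb : b * b = 1) (cc : c * c = 1) (ab : a * b = b * a) {T : Set G} (ha : a ∈ T) (hb : b ∈ T)
    (hc : c ∈ T) (hab : a * b ∈ T) {V : Type*} [AddCommGroup V] [Module ℝ V]
    (R : MajoranaRepresentation G T V) : False := by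
  have abab : a * b * (a * b) = 1 := by
    rw [mul_assoc, ← mul_assoc b, ← ab, mul_assoc, bb, mul_one, aa]
  have aab : a * (a * b) = b := by rw [← mul_assoc, aa, one_mul]
  have bab : b * (a * b) = a := by rw [ab, ← mul_assoc, bb, one_mul]
  have ca : a * (a * b) = a * b * a := by rw [ab, ← mul_assoc, ab]
  have cb : b * (a * b) = a * b * b := by rw [bab, mul_assoc, bb, mul_one]
  -- each homomorphism to `S₃` kills exactly one of `a`, `b`, `ab`
  have kill : ∀ f : G →* Equiv.Perm (Fin 3), (∃ g, f g ^ 2 ≠ 1) →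
      f a = 1 ∨ f b = 1 ∨ f (a * b) = 1 := by
    intro f hf
    obtain ⟨-, -, -, -, h⟩ := hgen.perm_three hf aa bb cc ab
    rcases h with h | h | h
    · exact Or.inl h.1
    · exact Or.inr (Or.inl h.2)
    · exact Or.inr (Or.inr (by rw [map_mul, h.1, map_mul_self _ bb]))
  have g1 : Generates a (a * b) c := hgen.mul_right
  have g2 : Generates b (a * b) c := by
    rw [ab]
    exact hgen.swap.mul_right
  rcases kill D.p D.p_large with hp | hp | hp <;> rcases kill D.q D.q_large with hq | hq | hq
  · exact D.not_fix_same hgen aa bb cc ab hp hq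
  · exact (good_of_generates hgen.swap bb aa cc ab.symm hp hq).no_representation hb ha hc
      (ab ▸ hab) R
  · exact (good_of_generates g1.swap abab aa cc ca.symm hp hq).no_representation hab ha hc
      (by rwa [← ca, aab]) R
  · exact (good_of_generates hgen aa bb cc ab hp hq).no_representation ha hb hc hab R
  · exact D.not_fix_same hgen.swap bb aa cc ab.symm hp hq
  · exact (good_of_generates g2.swap abab bb cc cb.symm hp hq).no_representation hab hb hc
      (by rwa [← cb, bab]) R
  · exact (good_of_generates g1 aa abab cc ca hp hq).no_representation ha hab hc
      (by rwa [aab]) R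
  · exact (good_of_generates g2 bb abab cc cb hp hq).no_representation hb hab hc
      (by rwa [bab]) R
  · exact D.not_fix_same g1.swap abab aa cc ca.symm hp hq

/-- If a homomorphism killed `ab` but not `a`, then `a·b^c` would map to a product of two distinct
involutions of `S₃`, of order 3, contrary to `h4`. So `p` and `q` kill `a` and `b` in some order. -/
theorem exists_good (D : DoubleS3Extension G) (hgen : Generates a b c) (aa : a * a = 1)
    (bb : b * b = 1) (cc : c * c = 1) (ab : a * b = b * a) (h4 : (a * conjBy b c) ^ 4 = 1) :
    ∃ D' : DoubleS3Extension G, D'.Good a b c := by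
  have kill : ∀ f : G →* Equiv.Perm (Fin 3), (∃ g, f g ^ 2 ≠ 1) → f a = 1 ∨ f b = 1 := by
    intro f hf
    obtain ⟨hc, hca, -, -, h⟩ := hgen.perm_three hf aa bb cc ab
    rcases h with h | h | ⟨h, h'⟩
    · exact Or.inl h.1
    · exact Or.inr h.2
    · exfalso
      refine perm_three_pow_four (f a) (f c) (map_mul_self _ aa) (map_mul_self _ cc) h' hc hca ?_
      have := congrArg f h4
      rwa [map_pow, map_mul, conjBy_apply_hom, ← h, map_one] at this
  rcases kill D.p D.p_large with hp | hp <;> rcases kill D.q D.q_large with hq | hq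
  · exact (D.not_fix_same hgen aa bb cc ab hp hq).elim
  · exact ⟨D.swap, good_of_generates (D := D.swap) hgen aa bb cc ab hq hp⟩
  · exact ⟨D, good_of_generates hgen aa bb cc ab hp hq⟩
  · exact (D.not_fix_same hgen.swap bb aa cc ab.symm hp hq).elim

/-- The homomorphism from the elementary abelian group of order `8` onto `⟨a, b, z⟩`. -/
def Good.hom (h : D.Good a b c) : Multiplicative (Fin 3 → ZMod 2) →* G :=
  have add : ∀ {x : G}, x * x = 1 → ∀ i j : ZMod 2, x ^ (i + j).val = x ^ i.val * x ^ j.val := by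
    intro x hx i j
    rw [← pow_add, ZMod.val_add, ← pow_mod_orderOf, ← pow_mod_orderOf x (i.val + j.val),
      Nat.mod_mod_of_dvd _ (orderOf_dvd_of_pow_eq_one (by rw [pow_two, hx]))]
  MonoidHom.mk' (fun v => a ^ (v.toAdd 0).val * b ^ (v.toAdd 1).val * D.z ^ (v.toAdd 2).val) (by
    intro v w
    have hz : ∀ g, Commute D.z g := D.z_comm
    have hba : Commute b a := h.ab.symm
    simp only [toAdd_mul, Pi.add_apply, add h.aa, add h.bb, add D.z_sq]
    generalize (v.toAdd 0).val = i
    generalize (v.toAdd 1).val = j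
    generalize (v.toAdd 2).val = k
    generalize (w.toAdd 0).val = i'
    generalize (w.toAdd 1).val = j'
    generalize (w.toAdd 2).val = k'
    have e1 : b ^ j * a ^ i' = a ^ i' * b ^ j := hba.pow_pow j i'
    have e2 : ∀ g, D.z ^ k * g = g * D.z ^ k := fun g => (hz g).pow_left k
    calc a ^ i * a ^ i' * (b ^ j * b ^ j') * (D.z ^ k * D.z ^ k') =
        a ^ i * (a ^ i' * b ^ j) * (b ^ j' * D.z ^ k) * D.z ^ k' := by simp only [mul_assoc]
      _ = a ^ i * b ^ j * (a ^ i' * D.z ^ k) * b ^ j' * D.z ^ k' := by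
        rw [← e1, ← e2]; simp only [mul_assoc, e2]
      _ = _ := by rw [← e2]; simp only [mul_assoc])

theorem Good.hom_apply (h : D.Good a b c) (v : Multiplicative (Fin 3 → ZMod 2)) :
    h.hom v = a ^ (v.toAdd 0).val * b ^ (v.toAdd 1).val * D.z ^ (v.toAdd 2).val := rfl

theorem Good.hom_injective (h : D.Good a b c) : Function.Injective h.hom := by
  rw [injective_iff_map_eq_one]
  intro v hv
  rw [h.hom_apply] at hv
  have two : ∀ {M : Type _} [Monoid M] {x : M}, x ≠ 1 → ∀ i : ZMod 2, x ^ i.val = 1 → i = 0 := by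
    intro M _ x hx i hi
    fin_cases i
    · rfl
    · exact absurd (by simpa [ZMod.val] using hi) hx
  -- On `a, b, z` the map `p` detects only `a` and `q` only `b`; once those exponents vanish, `ε`
  -- detects `z`.
  have h0 := congrArg D.p hv
  have h1 := congrArg D.q hv
  have h2 := congrArg D.ε hv
  simp only [map_mul, map_pow, h.pb, h.qa, D.p_z, D.q_z, D.ε_z, one_pow, mul_one, one_mul,
    map_one] at h0 h1 h2
  have e0 := two h.pa _ h0
  have e1 := two h.qb _ h1
  simp only [e0, e1, ZMod.val_zero, pow_zero, one_mul] at h2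
  have e2 := two (by decide) _ h2
  refine Multiplicative.toAdd.injective ?_
  funext i
  fin_cases i
  exacts [e0, e1, e2]

theorem Good.range_hom (h : D.Good a b c) : h.hom.range = subgroupK a b c := by
  rw [subgroupK, h.pow_three_eq_z]
  apply le_antisymm
  · rintro _ ⟨v, rfl⟩
    rw [h.hom_apply]
    exact mul_mem (mul_mem (pow_mem (Subgroup.subset_closure (by simp)) _)
      (pow_mem (Subgroup.subset_closure (by simp)) _)) (pow_mem (Subgroup.subset_closure (by simp)) _)
  · rw [Subgroup.closure_le]
    rintro x (rfl | rfl | rfl)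
    · exact ⟨Multiplicative.ofAdd ![1, 0, 0], by simp [h.hom_apply, ZMod.val_one]⟩
    · exact ⟨Multiplicative.ofAdd ![0, 1, 0], by simp [h.hom_apply, ZMod.val_one]⟩
    · exact ⟨Multiplicative.ofAdd ![0, 0, 1], by simp [h.hom_apply, ZMod.val_one]⟩

theorem Good.nonempty_mulEquiv (h : D.Good a b c) :
    Nonempty (subgroupK a b c ≃* Multiplicative (Fin 3 → ZMod 2)) :=
  ⟨(MulEquiv.subgroupCongr h.range_hom).symm.trans (MonoidHom.ofInjective h.hom_injective).symm⟩

theorem Good.subgroupK_subset (h : D.Good a b c) {T : Set G} (ha : a ∈ T) (hb : b ∈ T) (hc : c ∈ T)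
    (hab : a * b ∈ T) (conj : ∀ t ∈ T, ∀ g : G, g * t * g⁻¹ ∈ T)
    (cube : ∀ t ∈ T, ∀ s ∈ T, orderOf (t * s) = 6 → (t * s) ^ 3 ∈ T) :
    (subgroupK a b c : Set G) ⊆ T ∪ {1} := by
  obtain ⟨hz, haz, hbz, habz⟩ := h.mem hb ha hc hab conj cube
  rw [← h.range_hom]
  rintro _ ⟨v, rfl⟩
  rw [h.hom_apply]
  have two : ∀ i : ZMod 2, i.val = 0 ∨ i.val = 1 := by decide
  rcases two (v.toAdd 0) with h0 | h0 <;> rcases two (v.toAdd 1) with h1 | h1 <;>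
    rcases two (v.toAdd 2) with h2 | h2 <;>
    simp [h0, h1, h2, ha, hb, hab, hz, haz, hbz, habz]

end DoubleS3Extension

theorem mainTheorem9 {G : Type*} [Group G] (hG : Nonempty (G ≃* G9))
    (a b c : G) (habc : IsTrianglePoint a b c) :
    (∀ (T : Set G), a ∈ T → b ∈ T → c ∈ T → a * b ∈ T →
      ∀ (V : Type*) [AddCommGroup V] [Module ℝ V], IsEmpty (MajoranaRepresentation G T V)) ∧
    (SatisfiesG9Relations a b c →
      Nonempty (subgroupK a b c ≃* Multiplicative (Fin 3 → ZMod 2)) ∧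
      ∀ (T : Set G), a ∈ T → b ∈ T → c ∈ T → a * b ∈ T →
        (∀ t ∈ T, orderOf t = 2) →
        (∀ t ∈ T, ∀ g : G, g * t * g⁻¹ ∈ T) →
        (∀ t ∈ T, ∀ s ∈ T, orderOf (t * s) = 6 → (t * s) ^ 3 ∈ T) →
        (subgroupK a b c : Set G) ⊆ T ∪ {1}) := by
  obtain ⟨e⟩ := hG
  obtain ⟨D⟩ := G9.nonempty_doubleS3Extension
  have sq : ∀ {x : G}, orderOf x = 2 → x * x = 1 := fun hx => by
    rw [← pow_two, ← hx, pow_orderOf_eq_one]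
  have hgen := Generates.of_closure habc.generates
  have aa := sq habc.order_a
  have bb := sq habc.order_b
  have cc := sq habc.order_c
  have ab : a * b = b * a := by
    have h := inv_eq_of_mul_eq_one_left (sq habc.order_ab)
    rw [mul_inv_rev, inv_eq_of_mul_eq_one_left aa, inv_eq_of_mul_eq_one_left bb] at h
    exact h.symm
  refine ⟨fun T ha hb hc hab V _ _ =>
    ⟨fun R => (D.comap e).no_representation hgen aa bb cc ab ha hb hc hab R⟩, fun hrel => ?_⟩
  obtain ⟨D', h⟩ := (D.comap e).exists_good hgen aa bb cc ab hrel.2.2.2.2.2.2.2.1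
  exact ⟨h.nonempty_mulEquiv, fun T ha hb hc hab _ conj cube =>
    h.subgroupK_subset ha hb hc hab conj cube⟩
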